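/- **Theorem (Noise robust energy test).** Let $|n\rangle$, $n\in\mathbb N=\{0,1,2,\dots\}$, be the number states of one bosonic mode with Hilbert space $\ell^2(\mathbb N)$. Let $N,k_T,l_T\in\mathbb N$ with $k_T\ge 1$, let $T\subseteq\{1,\dots,N\}$ be a set of $k_T$ test rounds, and let $w\in[0,1]$, $n_c\in\mathbb N$ and $0<\beta_{\mathrm{test}}\le M$. For a density operator $\rho$ of one mode, let every mode of $\rho^{\otimes N}$ be measured by heterodyne detection, with a POVM density $E_y$ with respect to Lebesgue measure $d^2y$ on $\mathbb C$, so that the outcomes $(y_1,\dots,y_N)$ have joint density $\mathrm{Tr}[\rho^{\otimes N}(E_{y_1}\otimes\dots\otimes E_{y_N})]$. Because of the finite detection range, the real and the imaginary part of each outcome are clipped to $[-M,M]$; let $Y_j$ be the absolute value of the clipped outcome of round $j$. Put $W_1=\sum_{n\ge n_c}|n\rangle\langle n|$, let $\Pi^\perp$ be the projector onto the orthogonal complement of the cutoff space $\mathcal H^{n_c}=\mathrm{span}\{|0\rangle,\dots,|n_c\rangle\}$, and let $V_1=\int_{|y|\ge\beta_{\mathrm{test}}}E_y\,d^2y$. Let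 $\Gamma(s,x)=\int_x^\infty t^{s-1}e^{-t}\,dt$, $P_j=(1-\tfrac j{k_T},\tfrac j{k_T})$, $Q_y=(1-y,y)$, and let $D(P\|Q)=\sum_i P_i\log_2(P_i/Q_i)$ be the Kullback–Leibler divergence, with $0\log_2 0=0$. In each of the cases (i) and (ii) below, with the POVM density $E$ and the constant $r$ given there: (a) $W_1\le r\,V_1$ (as quadratic forms on $\ell^2(\mathbb N)$). (b) If $\frac{l_T}{k_T}<\frac wr$, then for every density operator $\rho$ with $\mathrm{Tr}[\Pi^\perp\rho]\ge w$, and more generally for every $\rho$ with $\mathrm{Tr}[W_1\rho]\ge w$, $$\Pr\Big[\big|\{j\in T: Y_j\ge\beta_{\mathrm{test}}\}\big|\le l_T\Big]\;\le\;(l_T+1)\cdot 2^{-k_T D(P_{l_T}\|Q_{w/r})}.$$ (i) *Ideal heterodyne detection:* $E_y=\frac1\pi|y\rangle\langle y|$ with the coherent states $|y\rangle=e^{-|y|^2/2}\sum_n\frac{y^n}{\sqrt{n!}}|n\rangle$, and $$r=\frac{\Gamma(n_c+1,0)}{\Gamma(n_c+1,\beta_{\mathrm{test}}^2)}.$$ (ii)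 *Trusted nonideal detectors* with efficiency $\eta_d\in(0,1]$ and electronic noise $\nu_{\mathrm{el}}\ge 0$: $E_y=\frac1{\eta_d\pi}\,\hat D\big(\tfrac y{\sqrt{\eta_d}}\big)\,\hat\rho_{\mathrm{th}}(\bar n_d)\,\hat D^\dagger\big(\tfrac y{\sqrt{\eta_d}}\big)$, where $\bar n_d=\frac{1-\eta_d+\nu_{\mathrm{el}}}{\eta_d}$, $\hat\rho_{\mathrm{th}}(\bar n)=\sum_k\frac{\bar n^k}{(1+\bar n)^{k+1}}|k\rangle\langle k|$ and $\hat D(\gamma)=\exp(\gamma\hat a^\dagger-\gamma^*\hat a)$, and, with $\tau=\frac{\eta_d}{1+\nu_{\mathrm{el}}}$, $$r=\Big[\sum_{j=0}^{n_c}\binom{n_c}{j}\tau^j(1-\tau)^{n_c-j}\,\frac{\Gamma(j+1,\beta_{\mathrm{test}}^2/(1+\nu_{\mathrm{el}}))}{\Gamma(j+1,0)}\Big]^{-1}$$ (for $\eta_d=1$, $\nu_{\mathrm{el}}=0$ this is the $r$ of case (i)). -/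

import Mathlib

open MeasureTheory

namespace CVQKD

noncomputable section

/-! ### Fock spaces, number states, trace -/

/-- `ℓ²(κ)`. -/
abbrev L2 (κ : Type) : Type := lp (fun _ : κ => ℂ) 2

/-- The Hilbert space of one bosonic mode, in the photon-number basis. -/
abbrev Mode : Type := L2 ℕ

/-- The Hilbert space of `N` modes, i.e. the `N`-fold Hilbert-space tensor power of `Mode`, in the
product number basis `|m 0⟩ ⊗ ⋯ ⊗ |m (N-1)⟩`, `m : Fin N → ℕ`. -/
abbrev MultiMode (N : ℕ) : Type := L2 (Fin N → ℕ)

/-- The basis vector `|m⟩`; for `κ = ℕ` this is the number state with `m` photons. -/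
def ket {κ : Type} [DecidableEq κ] (m : κ) : L2 κ := lp.single 2 m (1 : ℂ)

/-- The trace in the number basis, `∑ₘ ⟨m|A|m⟩`. It is only ever applied to trace-class
operators. -/
def tr {κ : Type} [DecidableEq κ] (A : L2 κ →L[ℂ] L2 κ) : ℂ :=
  ∑' m : κ, inner ℂ (ket m) (A (ket m))

/-- A density operator of one mode: positive with trace one. -/
structure DensityOperator where
  op : Mode →L[ℂ] Mode
  isPositive : op.IsPositive
  trace_one : HasSum (fun n : ℕ => inner ℂ (ket n) (op (ket n))) 1

/-! ### Tensor products of one-mode operators -/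

theorem memlp_slice {N : ℕ} (i : Fin N) (m : Fin N → ℕ) (x : MultiMode N) :
    Memℓp (fun j : ℕ => x (Function.update m i j)) 2 := by
  have h := (memℓp_gen_iff (p := 2) (by norm_num)).1 (lp.memℓp x)
  refine (memℓp_gen_iff (p := 2) (by norm_num)).2 ?_
  exact h.comp_injective (Function.update_injective m i)

/-- The coordinates of `x` along the `i`-th mode, the other modes being in the number states
given by `m`. -/
def slice {N : ℕ} (i : Fin N) (m : Fin N → ℕ) (x : MultiMode N) : Mode :=
  ⟨fun j : ℕ => x (Function.update m i j), memlp_slice i m x⟩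

theorem enorm_sq_eq_tsum {κ : Type} (x : L2 κ) : ‖x‖ₑ ^ 2 = ∑' m, ‖x m‖ₑ ^ 2 := by
  have hs := (memℓp_gen_iff (p := 2) (by norm_num)).1 (lp.memℓp x)
  have h := lp.norm_rpow_eq_tsum (p := 2) (by norm_num) x
  simp only [ENNReal.toReal_ofNat, Real.rpow_two] at h hs
  rw [← ofReal_norm, ← ENNReal.ofReal_pow (norm_nonneg _), h,
    ENNReal.ofReal_tsum_of_nonneg (fun _ => by positivity) hs]
  refine tsum_congr fun m => ?_
  rw [ENNReal.ofReal_pow (norm_nonneg _), ofReal_norm]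

theorem memlp_iff_tsum_ne_top {κ : Type} (f : κ → ℂ) :
    Memℓp f 2 ↔ ∑' m, ‖f m‖ₑ ^ 2 ≠ ⊤ := by
  rw [memℓp_gen_iff (p := 2) (by norm_num)]
  simp only [ENNReal.toReal_ofNat, Real.rpow_two]
  have h : ∀ m, ‖f m‖ₑ ^ 2 = ((‖f m‖₊ ^ 2 : NNReal) : ENNReal) := fun m => by
    simp [enorm_eq_nnnorm]
  simp only [h]
  rw [ENNReal.tsum_coe_ne_top_iff_summable, ← NNReal.summable_coe]
  simp

theorem tsum_slice {N : ℕ} (i : Fin N) (f : (Fin N → ℕ) → ENNReal) :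
    ∑' m, f m = ∑' (m' : {j // j ≠ i} → ℕ) (k : ℕ),
      f ((Equiv.funSplitAt i ℕ).symm (k, m')) := by
  rw [← (Equiv.funSplitAt i ℕ).symm.tsum_eq, ENNReal.tsum_prod', ENNReal.tsum_comm]

theorem update_split {N : ℕ} (i : Fin N) (k j : ℕ) (m' : {j // j ≠ i} → ℕ) :
    Function.update ((Equiv.funSplitAt i ℕ).symm (k, m')) i j
      = (Equiv.funSplitAt i ℕ).symm (j, m') := by
  funext a
  by_cases h : a = i
  · subst h; simp
  · simp [h]

theorem tsum_site_le {N : ℕ} (i : Fin N) (A : Mode →L[ℂ] Mode) (x : MultiMode N) :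
    ∑' m, ‖A (slice i m x) (m i)‖ₑ ^ 2 ≤ ‖A‖ₑ ^ 2 * ‖x‖ₑ ^ 2 := by
  rw [tsum_slice i, enorm_sq_eq_tsum x, tsum_slice i (fun m => ‖x m‖ₑ ^ 2), ← ENNReal.tsum_mul_left]
  refine ENNReal.tsum_le_tsum fun m' => ?_
  set s : Mode := slice i ((Equiv.funSplitAt i ℕ).symm (0, m')) x with hs
  have h1 : ∀ k, slice i ((Equiv.funSplitAt i ℕ).symm (k, m')) x = s := fun k => by
    apply Subtype.ext
    funext j
    simp only [hs, slice, update_split]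
  have h2 : ∀ k : ℕ, ((Equiv.funSplitAt i ℕ).symm (k, m')) i = k := fun k => by simp
  simp only [h1, h2]
  rw [← enorm_sq_eq_tsum]
  have h3 : ∑' k, ‖x ((Equiv.funSplitAt i ℕ).symm (k, m'))‖ₑ ^ 2 = ‖s‖ₑ ^ 2 := by
    rw [enorm_sq_eq_tsum]
    refine tsum_congr fun k => ?_
    simp only [hs, slice, update_split]
  rw [h3, ← mul_pow]
  gcongr
  exact A.le_opENorm s

theorem memlp_site {N : ℕ} (i : Fin N) (A : Mode →L[ℂ] Mode) (x : MultiMode N) :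
    Memℓp (fun m : Fin N → ℕ => A (slice i m x) (m i)) 2 := by
  rw [memlp_iff_tsum_ne_top]
  refine ne_top_of_le_ne_top ?_ (tsum_site_le i A x)
  finiteness

/-- The operator `1 ⊗ ⋯ ⊗ A ⊗ ⋯ ⊗ 1` on `N` modes with `A` acting on the `i`-th mode. -/
def siteOp {N : ℕ} (i : Fin N) (A : Mode →L[ℂ] Mode) : MultiMode N →L[ℂ] MultiMode N :=
  LinearMap.mkContinuous
    { toFun := fun x => ⟨fun m => A (slice i m x) (m i), memlp_site i A x⟩
      map_add' := fun x y => by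
        apply Subtype.ext
        funext m
        have h : slice i m (x + y) = slice i m x + slice i m y := rfl
        change A (slice i m (x + y)) (m i) = _
        rw [h, map_add]
        rfl
      map_smul' := fun c x => by
        apply Subtype.ext
        funext m
        have h : slice i m (c • x) = c • slice i m x := rfl
        change A (slice i m (c • x)) (m i) = _
        rw [h, map_smul]
        rfl }
    ‖A‖ (fun x => by
      have h := tsum_site_le i A x
      set y : MultiMode N := ⟨fun m => A (slice i m x) (m i), memlp_site i A x⟩ with hy
      have h' : ‖y‖ₑ ^ 2 ≤ (‖A‖ₑ * ‖x‖ₑ) ^ 2 := by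
        rw [enorm_sq_eq_tsum, mul_pow]
        exact h
      have h2 : ‖y‖ₑ ≤ ‖A‖ₑ * ‖x‖ₑ := (ENNReal.pow_le_pow_left_iff two_ne_zero).1 h'
      have h3 := ENNReal.toReal_mono (by finiteness) h2
      rw [ENNReal.toReal_mul] at h3
      simpa using h3)

/-- The tensor product `A 0 ⊗ A 1 ⊗ ⋯ ⊗ A (N-1)`, as the product of the (commuting) one-mode
operators acting on the respective modes. -/
def tensorOp {N : ℕ} (A : Fin N → (Mode →L[ℂ] Mode)) : MultiMode N →L[ℂ] MultiMode N :=
  ((List.finRange N).map fun i => siteOp i (A i)).prod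

/-- The i.i.d. state `ρ^{⊗N}`. -/
def DensityOperator.tensorPow (ρ : DensityOperator) (N : ℕ) : MultiMode N →L[ℂ] MultiMode N :=
  tensorOp fun _ => ρ.op

/-! ### The photon-number cutoff -/

/-- The cutoff space `H^{n_c}`: the span of the number states `|0⟩, …, |n_c⟩`. -/
def cutoffSpace (nc : ℕ) : Submodule ℂ Mode :=
  Submodule.span ℂ {v | ∃ n : ℕ, n ≤ nc ∧ v = ket n}

/-- `Π^⊥`: the projector onto the orthogonal complement of the cutoff space. -/
def cutoffCompl (nc : ℕ) : Mode →L[ℂ] Mode := (cutoffSpace nc)ᗮ.starProjection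

/-- `W₁ = ∑_{n ≥ n_c} |n⟩⟨n|`: the projector onto the closed span of the number states with at
least `n_c` photons. -/
def tailProj (nc : ℕ) : Mode →L[ℂ] Mode :=
  (Submodule.span ℂ {v : Mode | ∃ n : ℕ, nc ≤ n ∧ v = ket n}).topologicalClosure.starProjection

/-! ### Heterodyne detection -/

theorem memlp_coherent (γ : ℂ) :
    Memℓp (fun n : ℕ => (Real.exp (-‖γ‖ ^ 2 / 2) : ℂ) * γ ^ n / (Real.sqrt n.factorial : ℂ)) 2 := by
  refine (memℓp_gen_iff (p := 2) (by norm_num)).2 ?_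
  have h := (Real.summable_pow_div_factorial (‖γ‖ ^ 2)).mul_left (Real.exp (-‖γ‖ ^ 2 / 2) ^ 2)
  refine h.congr fun n => ?_
  simp only [ENNReal.toReal_ofNat, Real.rpow_two, norm_div, norm_mul, norm_pow,
    Complex.norm_real, Real.norm_eq_abs, div_pow, mul_pow, sq_abs]
  rw [Real.sq_sqrt (by positivity)]
  ring

/-- The coherent state `|γ⟩ = e^{-|γ|²/2} ∑ₙ γⁿ/√(n!) |n⟩`. -/
def coherent (γ : ℂ) : Mode :=
  ⟨fun n : ℕ => (Real.exp (-‖γ‖ ^ 2 / 2) : ℂ) * γ ^ n / (Real.sqrt n.factorial : ℂ),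
    memlp_coherent γ⟩

/-- The POVM density of the ideal heterodyne measurement, `E_γ = (1/π) |γ⟩⟨γ|`. -/
def idealPOVM (γ : ℂ) : Mode →L[ℂ] Mode :=
  ((1 / Real.pi : ℝ) : ℂ) • InnerProductSpace.rankOne ℂ (coherent γ) (coherent γ)

/-- The creation operator on finite superpositions of number states, `a† |n⟩ = √(n+1) |n+1⟩`. -/
def creation : (ℕ →₀ ℂ) →ₗ[ℂ] (ℕ →₀ ℂ) :=
  Finsupp.linearCombination ℂ fun n : ℕ => Finsupp.single (n + 1) (Real.sqrt (n + 1 : ℝ) : ℂ)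

/-- The annihilation operator on finite superpositions of number states,
`a |n⟩ = √n |n-1⟩`, `a |0⟩ = 0`. -/
def annihilation : (ℕ →₀ ℂ) →ₗ[ℂ] (ℕ →₀ ℂ) :=
  Finsupp.linearCombination ℂ fun n : ℕ => Finsupp.single (n - 1) (Real.sqrt (n : ℝ) : ℂ)

/-- The generator `γ a† - γ* a` of the displacement operator. -/
def dispGen (γ : ℂ) : (ℕ →₀ ℂ) →ₗ[ℂ] (ℕ →₀ ℂ) :=
  γ • creation - (starRingEnd ℂ γ) • annihilation

/-- The displaced number state `D(γ)|k⟩` with `D(γ) = exp(γ a† - γ* a)`; the exponential series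
converges in norm on number states. -/
def displacedKet (γ : ℂ) (k : ℕ) : Mode :=
  ∑' j : ℕ, ((j.factorial : ℂ)⁻¹) •
    Finsupp.linearCombination ℂ (fun n : ℕ => (ket n : Mode))
      ((dispGen γ ^ j) (Finsupp.single k 1))

/-- The displaced thermal state `D(γ) ρ_th(n̄) D(γ)†`, where
`ρ_th(n̄) = ∑ₖ n̄ᵏ/(1+n̄)^{k+1} |k⟩⟨k|` is the thermal state of mean photon number `n̄`. -/
def displacedThermal (nbar : ℝ) (γ : ℂ) : Mode →L[ℂ] Mode :=
  ∑' k : ℕ, ((nbar ^ k / (1 + nbar) ^ (k + 1) : ℝ) : ℂ) •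
    InnerProductSpace.rankOne ℂ (displacedKet γ k) (displacedKet γ k)

/-- The POVM density of the trusted nonideal heterodyne measurement with detection efficiency `η`
and electronic noise `ν`:
`G_y = 1/(η π) D(y/√η) ρ_th(n̄) D(y/√η)†` with `n̄ = (1 - η + ν)/η`. -/
def nonidealPOVM (η ν : ℝ) (y : ℂ) : Mode →L[ℂ] Mode :=
  ((1 / (η * Real.pi) : ℝ) : ℂ) • displacedThermal ((1 - η + ν) / η) (y / (Real.sqrt η : ℂ))

/-- The quadratic form `⟨ψ|V₁|ψ⟩` of the test operator `V₁ = ∫_{|y| ≥ β} E_y d²y`. -/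
def testForm (E : ℂ → (Mode →L[ℂ] Mode)) (β : ℝ) (ψ : Mode) : ℝ :=
  ∫ y in {y : ℂ | β ≤ ‖y‖}, (inner ℂ ψ (E y ψ)).re

/-- Born's rule: the joint law of the outcomes `(y 0, …, y (N-1))` when every mode of `ρ^{⊗N}` is
measured with the POVM of density `E`; its Lebesgue density is `Tr[ρ^{⊗N} (E_{y 0} ⊗ ⋯)]`. -/
def outcomeLaw (E : ℂ → (Mode →L[ℂ] Mode)) (ρ : DensityOperator) (N : ℕ) :
    Measure (Fin N → ℂ) :=
  volume.withDensity fun y =>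
    ENNReal.ofReal (tr (ρ.tensorPow N ∘L tensorOp fun i => E (y i))).re

/-- The finite detection range: real and imaginary part of an outcome are clipped to `[-M, M]`. -/
def clip (M : ℝ) (y : ℂ) : ℂ := ⟨max (-M) (min M y.re), max (-M) (min M y.im)⟩

/-- The event that the energy test passes: among the tested rounds `j ∈ T`, at most `l` have
`Y_j ≥ β`, where `Y_j` is the absolute value of the recorded outcome. -/
def passes {N : ℕ} (T : Finset (Fin N)) (l : ℕ) (β M : ℝ) : Set (Fin N → ℂ) :=
  {y | (T.filter fun j => β ≤ ‖clip M (y j)‖).card ≤ l}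

/-! ### The constants of the bound -/

/-- The upper incomplete gamma function `Γ(s, x) = ∫_x^∞ t^{s-1} e^{-t} dt`. -/
def upperGamma (s x : ℝ) : ℝ := ∫ t in Set.Ioi x, t ^ (s - 1) * Real.exp (-t)

/-- `r = Γ(n_c+1, 0) / Γ(n_c+1, β²)`. -/
def rIdeal (nc : ℕ) (β : ℝ) : ℝ := upperGamma (nc + 1) 0 / upperGamma (nc + 1) (β ^ 2)

/-- The constant for the nonideal detector: the inverse of
`∑_{j ≤ n_c} C(n_c, j) τ^j (1-τ)^{n_c-j} Γ(j+1, β²/(1+ν)) / Γ(j+1, 0)`, `τ = η/(1+ν)`. -/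
def rNonideal (η ν : ℝ) (nc : ℕ) (β : ℝ) : ℝ :=
  (∑ j ∈ Finset.range (nc + 1),
    (nc.choose j : ℝ) * (η / (1 + ν)) ^ j * (1 - η / (1 + ν)) ^ (nc - j) *
      (upperGamma (j + 1) (β ^ 2 / (1 + ν)) / upperGamma (j + 1) 0))⁻¹

/-- The Kullback-Leibler divergence in bits, `∑ᵢ Pᵢ log₂ (Pᵢ / Qᵢ)` with `0 log 0 = 0`, for `Q`
without zeros. -/
def kl {ι : Type} [Fintype ι] (P Q : ι → ℝ) : ℝ := ∑ i, P i * Real.logb 2 (P i / Q i)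

/-- The distribution `(1 - y, y)`. -/
def binary (y : ℝ) : Fin 2 → ℝ := ![1 - y, y]

/-- `ε_ET = (l + 1) 2^{-k D(P_l ‖ Q_y)}` with `P_l = (1 - l/k, l/k)` and `Q_y = (1 - y, y)`. -/
def epsET (k l : ℕ) (y : ℝ) : ℝ :=
  (l + 1) * (2 : ℝ) ^ (-(k : ℝ) * kl (binary ((l : ℝ) / k)) (binary y))

end

end CVQKD

namespace CVQKD

noncomputable section

/-! ### The displacement polynomials -/

/-! The ideal detector is the nonideal one with `η = 1`, `ν = 0`, so only the latter is treated. Its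
POVM density is covariant under phase rotations, so `V₁`, an integral over a rotation-invariant
region, is diagonal in the number basis. Its `n`-th eigenvalue `testWeight η ν n β` is the average,
over `j` binomial with parameters `n` and `τ = η/(1+ν)`, of the probability `Γ(j+1, x)/j!` that a
Poisson variable of mean `x = β²/(1+ν)` is at most `j`. This increases with `n`, and its value at
`nc` is `1/r`. Hence `V₁` dominates `W₁/r`, which is (a).

The eigenvalue rests on three computations. The exponential series of `γ a† - γ* a` on number states
is identified with explicit polynomial matrix elements (`displacedKet_apply`). A generating function
(`hasSum_dispPoly_mul`) sums their squares against the geometric thermal weights, whose ratio is `1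
- τ`, and produces the binomial mixture. Parseval on circles removes the off-diagonal terms, and the
remaining radial integral has an explicit antiderivative (`lintegral_povmForm`).

For (b), Born's rule on a product state gives independent rounds with a common density. A round
reaches `β` with probability `b ≥ Tr[W₁ρ]/r ≥ y = w/r`; clipping is harmless because `β ≤ M`. For `0
≤ s ≤ 1`, Markov's inequality for `s^(number of exceedances)` gives `s^l · Pr ≤ (1 - b + b s)^k ≤ (1
- y + y s)^k`, and the optimal `s` turns this into `2^(-k D)`. The prefactor `l + 1` is slack. -/

theorem _root_.HasSum.of_eq {α ι : Type*} [AddCommMonoid α] [TopologicalSpace α] {f g : ι → α}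
    {x y : α} (h : HasSum f x) (hf : ∀ i, g i = f i) (hx : y = x) : HasSum g y := by
  rw [hx, funext hf]
  exact h

/-- The polynomials `∑ⱼ C(n,j) C(k,j) j! qʲ a^{n-j} b^{k-j}`, by recursion on `k`. For `q = 1` they
are, up to normalization, the matrix elements of the displacement operators. -/
def dispPoly {R : Type*} [CommRing R] (a b q : R) : ℕ → ℕ → R
  | n, 0 => a ^ n
  | n, k + 1 => b * dispPoly a b q n k + q * n * dispPoly a b q (n - 1) k

section dispPoly

variable {R : Type*} [CommRing R] (a b q : R)

theorem dispPoly_zero_right (n : ℕ) : dispPoly a b q n 0 = a ^ n := by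
  rw [dispPoly]

theorem dispPoly_succ_right (n k : ℕ) :
    dispPoly a b q n (k + 1) = b * dispPoly a b q n k + q * n * dispPoly a b q (n - 1) k := by
  rw [dispPoly]

theorem dispPoly_succ_left (n k : ℕ) :
    dispPoly a b q (n + 1) k = a * dispPoly a b q n k + q * k * dispPoly a b q n (k - 1) := by
  induction k generalizing n with
  | zero => simp [dispPoly_zero_right, pow_succ']
  | succ k ih =>
    rw [dispPoly_succ_right, dispPoly_succ_right, ih n]
    simp only [Nat.add_sub_cancel]
    rcases n with _ | n
    · rcases k with _ | k
      · simp
        ring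
      · rw [show k + 1 - 1 = k from rfl, dispPoly_succ_right a b q 0 k]
        push_cast
        ring
    · simp only [Nat.add_sub_cancel]
      have h1 := ih n
      rcases k with _ | k
      · simp at h1 ⊢
        rw [h1]
        ring
      · simp only [Nat.add_sub_cancel] at h1 ⊢
        have h2 := dispPoly_succ_right a b q (n + 1) k
        simp only [Nat.add_sub_cancel] at h2
        push_cast at h1 h2 ⊢
        linear_combination (n + 1 : R) * q * h1 - (k + 1 : R) * q * h2

theorem dispPoly_zero_left (k : ℕ) : dispPoly a b q 0 k = b ^ k := by
  induction k with
  | zero => simp [dispPoly_zero_right]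
  | succ k ih => simp [dispPoly_succ_right, ih, pow_succ']

theorem dispPoly_comm (n k : ℕ) : dispPoly a b q n k = dispPoly b a q k n := by
  induction n generalizing k with
  | zero => rw [dispPoly_zero_left, dispPoly_zero_right]
  | succ n ih => rw [dispPoly_succ_left, dispPoly_succ_right, ih, ih]

/-- The monomial `a^(n-j) b^(k-j)` picks up `z^(n-k)`, independently of `j`; the factor `z ^ k` on
the left avoids a negative exponent. For unit complex `z` this becomes the phase covariance of
displacements. -/
theorem dispPoly_rotate {z w : R} (hzw : z * w = 1) (n k : ℕ) :
    dispPoly (z * a) (w * b) q n k * z ^ k = z ^ n * dispPoly a b q n k := by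
  induction k generalizing n with
  | zero => simp [dispPoly_zero_right, mul_pow]
  | succ k ih =>
    rw [dispPoly_succ_right, dispPoly_succ_right]
    have h0 := ih n
    rcases n with _ | n
    · simp at h0 ⊢
      linear_combination (b * z * w) * h0 + b * dispPoly a b q 0 k * hzw
    · have h1 := ih n
      simp only [Nat.add_sub_cancel]
      push_cast
      linear_combination (b * z * w) * h0 + b * z ^ (n + 1) * dispPoly a b q (n + 1) k * hzw
        + q * (n + 1) * z * h1

theorem dispPoly_map {S : Type*} [CommRing S] (f : R →+* S) (n k : ℕ) :
    dispPoly (f a) (f b) (f q) n k = f (dispPoly a b q n k) := by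
  induction k generalizing n with
  | zero => simp [dispPoly_zero_right]
  | succ k ih => simp [dispPoly_succ_right, ih]

theorem dispPoly_eq_sum (n k : ℕ) :
    dispPoly a b q n k = ∑ j ∈ Finset.range (k + 1),
      (n.choose j : R) * (k.choose j : R) * (j.factorial : R) * q ^ j * a ^ (n - j) * b ^ (k - j) := by
  induction k generalizing n with
  | zero => simp [dispPoly_zero_right]
  | succ k ih =>
    rw [dispPoly_succ_right, ih, ih, Finset.sum_range_succ' _ (k + 1), Finset.mul_sum,
      Finset.mul_sum]
    -- Pascal's rule in `k` splits each term; the part with `k.choose j` is rewritten by `n C(n-1,j)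
    -- = (j+1) C(n,j+1)`.
    have hsplit : ∀ j ∈ Finset.range (k + 1),
        (n.choose (j + 1) : R) * ((k + 1).choose (j + 1) : R) * ((j + 1).factorial : R) * q ^ (j + 1)
          * a ^ (n - (j + 1)) * b ^ (k + 1 - (j + 1)) =
        q * n * (((n - 1).choose j : R) * (k.choose j : R) * (j.factorial : R) * q ^ j
          * a ^ (n - 1 - j) * b ^ (k - j)) +
        (n.choose (j + 1) : R) * (k.choose (j + 1) : R) * ((j + 1).factorial : R) * q ^ (j + 1)
          * a ^ (n - (j + 1)) * b ^ (k - j) := by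
      intro j _
      have h1 : (n : R) * ((n - 1).choose j : R) = (n.choose (j + 1) : R) * (j + 1) := by
        rcases n with _ | n
        · simp
        · have := Nat.add_one_mul_choose_eq n j
          simp only [Nat.add_sub_cancel]
          exact_mod_cast congrArg (Nat.cast (R := R)) this
      rw [Nat.choose_succ_succ k j, Nat.factorial_succ, Nat.add_sub_add_right,
        show n - 1 - j = n - (j + 1) by omega]
      push_cast
      linear_combination (-(k.choose j : R) * (j.factorial : R) * q ^ (j + 1)
          * a ^ (n - (j + 1)) * b ^ (k - j)) * h1
    rw [Finset.sum_congr rfl hsplit, Finset.sum_add_distrib, Finset.sum_range_succ' _ k]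
    have hlast : ∑ j ∈ Finset.range (k + 1),
        (n.choose (j + 1) : R) * (k.choose (j + 1) : R) * ((j + 1).factorial : R) * q ^ (j + 1)
          * a ^ (n - (j + 1)) * b ^ (k - j) =
        ∑ j ∈ Finset.range k, b * ((n.choose (j + 1) : R) * (k.choose (j + 1) : R)
          * ((j + 1).factorial : R) * q ^ (j + 1) * a ^ (n - (j + 1)) * b ^ (k - (j + 1))) := by
      rw [Finset.sum_range_succ]
      simp only [Nat.choose_succ_self, Nat.cast_zero, mul_zero, zero_mul, add_zero]
      refine Finset.sum_congr rfl fun j hj => ?_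
      rw [show k - j = (k - (j + 1)) + 1 by have := Finset.mem_range.1 hj; omega, pow_succ]
      ring
    rw [hlast]
    simp
    ring

/-- Chain rule for `∂P_{n,k}/∂a = n P_{n-1,k}` and `∂P_{n,k}/∂b = k P_{n,k-1}`. Truncated
subtraction is harmless, since the prefactor vanishes at index `0`. -/
theorem hasDerivAt_dispPoly (a b : ℂ) (n k : ℕ) (s : ℂ) :
    HasDerivAt (fun s : ℂ => dispPoly (s * a) (s * b) 1 n k)
      (n * a * dispPoly (s * a) (s * b) 1 (n - 1) k
        + k * b * dispPoly (s * a) (s * b) 1 n (k - 1)) s := by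
  induction k generalizing n with
  | zero =>
    simp only [dispPoly_zero_right]
    have h := ((hasDerivAt_id s).mul_const a).pow n
    refine h.congr_deriv ?_
    simp
    ring
  | succ k ih =>
    simp only [dispPoly_succ_right]
    have h := (((hasDerivAt_id s).mul_const b).mul (ih n)).add
      ((hasDerivAt_const s ((1 : ℂ) * n)).mul (ih (n - 1)))
    refine h.congr_deriv ?_
    simp only [Nat.add_sub_cancel, id]
    rcases k with _ | k
    · rcases n with _ | n
      · simp
      · simp
        ring
    · simp only [Nat.add_sub_cancel]
      rw [dispPoly_succ_right _ _ _ n k]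
      push_cast
      ring

/-- Expand `P_{n+1,k} = a P_{n,k} + k P_{n,k-1}`. In the second part the factor `k` cancels against
`k!`; after shifting `k`, the recursion of `P_{m,k+1}` produces `q (b X + m Y)`. The outcome has the
form of the left recursion with `a + q b` in place of `a`, which drives the induction for the
generating function. -/
theorem hasSum_dispPoly_succ {a b q : ℝ} {n m : ℕ} {X Y : ℝ}
    (hX : HasSum (fun k : ℕ => q ^ k / k.factorial * (dispPoly a b 1 n k * dispPoly a b 1 m k)) X)
    (hY : HasSum (fun k : ℕ =>
      q ^ k / k.factorial * (dispPoly a b 1 n k * dispPoly a b 1 (m - 1) k)) Y) :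
    HasSum (fun k : ℕ => q ^ k / k.factorial * (dispPoly a b 1 (n + 1) k * dispPoly a b 1 m k))
      ((a + q * b) * X + q * m * Y) := by
  have h1 : HasSum (fun k : ℕ =>
      q ^ k / k.factorial * (k * dispPoly a b 1 n (k - 1) * dispPoly a b 1 m k))
      (q * b * X + q * m * Y) := by
    rw [← hasSum_nat_add_iff' 1]
    simp only [Finset.range_one, Finset.sum_singleton, Nat.cast_zero, zero_mul, mul_zero, sub_zero]
    refine ((hX.mul_left (q * b)).add (hY.mul_left (q * m))).of_eq (fun k => ?_) (by ring)
    rw [dispPoly_succ_right, Nat.factorial_succ, Nat.add_sub_cancel]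
    have : (k.factorial : ℝ) ≠ 0 := by positivity
    have : (k + 1 : ℝ) ≠ 0 := by positivity
    push_cast
    field_simp
    ring
  refine ((hX.mul_left a).add h1).of_eq (fun k => ?_) ?_
  · rw [dispPoly_succ_left]
    ring
  · ring

theorem hasSum_dispPoly_mul (a b q : ℝ) (n m : ℕ) :
    HasSum (fun k : ℕ => q ^ k / k.factorial * (dispPoly a b 1 n k * dispPoly a b 1 m k))
      (Real.exp (q * b ^ 2) * dispPoly (a + q * b) (a + q * b) q n m) := by
  have h0 : ∀ m, HasSum (fun k : ℕ =>
      q ^ k / k.factorial * (dispPoly a b 1 m k * dispPoly a b 1 0 k))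
      (Real.exp (q * b ^ 2) * (a + q * b) ^ m) := by
    intro m
    induction m with
    | zero =>
      have h := NormedSpace.expSeries_div_hasSum_exp (q * b ^ 2)
      rw [← Real.exp_eq_exp_ℝ] at h
      refine h.of_eq (fun k => ?_) (by simp)
      rw [dispPoly_zero_left]
      ring
    | succ m ih =>
      refine (hasSum_dispPoly_succ ih ih).of_eq (fun k => rfl) ?_
      simp
      ring
  induction n generalizing m with
  | zero =>
    simp_rw [mul_comm (dispPoly a b 1 0 _)]
    rw [dispPoly_zero_left]
    exact h0 m
  | succ n ih =>
    refine (hasSum_dispPoly_succ (ih m) (ih (m - 1))).of_eq (fun k => rfl) ?_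
    rw [dispPoly_succ_left]
    ring

end dispPoly

/-! ### Matrix elements of the displacement exponential -/

theorem dispPoly_zero_zero {R : Type*} [CommRing R] (n k : ℕ) :
    dispPoly (0 : R) 0 1 n k = if n = k then (k.factorial : R) else 0 := by
  induction k generalizing n with
  | zero =>
    rcases n with _ | n <;> simp [dispPoly_zero_right]
  | succ k ih =>
    rw [dispPoly_succ_right, ih (n - 1)]
    rcases n with _ | n
    · simp
    · by_cases h : n = k
      · subst h
        simp [Nat.factorial_succ]
      · simp [h]

/-- The matrix element `⟨n|D(γ)|k⟩` of the displacement operator. -/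
def dispCoeff (γ : ℂ) (n k : ℕ) : ℂ :=
  (Real.exp (-‖γ‖ ^ 2 / 2) : ℂ) / ((Real.sqrt n.factorial : ℂ) * (Real.sqrt k.factorial : ℂ))
    * dispPoly γ (-(starRingEnd ℂ γ)) 1 n k

/-- The matrix element `⟨n|exp(s (γ a† - γ* a))|k⟩`, an entire function of `s`. -/
def dispFlow (γ : ℂ) (n k : ℕ) (s : ℂ) : ℂ :=
  Complex.exp (s ^ 2 * (γ * -(starRingEnd ℂ γ)) / 2)
    / ((Real.sqrt n.factorial : ℂ) * (Real.sqrt k.factorial : ℂ))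
    * dispPoly (s * γ) (s * -(starRingEnd ℂ γ)) 1 n k

theorem sqrt_factorial_ne_zero (n : ℕ) : (Real.sqrt n.factorial : ℂ) ≠ 0 := by
  rw [Complex.ofReal_ne_zero, Real.sqrt_ne_zero']
  positivity

theorem sqrt_factorial_succ (n : ℕ) :
    (Real.sqrt (n + 1).factorial : ℂ) = (Real.sqrt (n + 1 : ℝ) : ℂ) * (Real.sqrt n.factorial : ℂ) := by
  rw [← Complex.ofReal_mul, ← Real.sqrt_mul (by positivity), Nat.factorial_succ]
  push_cast
  rfl

theorem ofReal_sqrt_mul_self {x : ℝ} (hx : 0 ≤ x) :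
    (Real.sqrt x : ℂ) * (Real.sqrt x : ℂ) = (x : ℂ) := by
  rw [← Complex.ofReal_mul, Real.mul_self_sqrt hx]

theorem dispGen_single (γ : ℂ) (k : ℕ) :
    dispGen γ (Finsupp.single k 1) =
      (γ * (Real.sqrt (k + 1 : ℝ) : ℂ)) • Finsupp.single (k + 1) 1
        - (starRingEnd ℂ γ * (Real.sqrt (k : ℝ) : ℂ)) • Finsupp.single (k - 1) 1 := by
  simp [dispGen, creation, annihilation, Finsupp.linearCombination_single]

theorem dispFlow_zero (γ : ℂ) (n k : ℕ) : dispFlow γ n k 0 = if k = n then 1 else 0 := by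
  rw [dispFlow, zero_mul, zero_mul, dispPoly_zero_zero]
  by_cases h : n = k
  · subst h
    have h1 : (Real.sqrt n.factorial : ℂ) ≠ 0 := sqrt_factorial_ne_zero n
    have h2 := ofReal_sqrt_mul_self (x := n.factorial) (by positivity)
    rw [h2]
    have : (n.factorial : ℂ) ≠ 0 := by exact_mod_cast n.factorial_ne_zero
    simp [this]
  · simp [h, Ne.symm h]

/-- With `G = γ a† - γ* a`, this is `d/ds ⟨n|exp(sG)|k⟩ = ⟨n|exp(sG) G|k⟩`. The derivative `s γ b`
of the Gaussian exponent and the `a`-derivative of the polynomial combine into `γ P_{n,k+1}` by the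
recursion in `k`; the `b`-derivative is the lowering term. -/
theorem hasDerivAt_dispFlow (γ : ℂ) (n k : ℕ) (s : ℂ) :
    HasDerivAt (dispFlow γ n k)
      (γ * (Real.sqrt (k + 1 : ℝ) : ℂ) * dispFlow γ n (k + 1) s
        - starRingEnd ℂ γ * (Real.sqrt (k : ℝ) : ℂ) * dispFlow γ n (k - 1) s) s := by
  set b : ℂ := -(starRingEnd ℂ γ) with hb
  have hb' : starRingEnd ℂ γ = -b := by rw [hb, neg_neg]
  have he : HasDerivAt (fun s : ℂ => Complex.exp (s ^ 2 * (γ * b) / 2))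
      (Complex.exp (s ^ 2 * (γ * b) / 2) * (s * (γ * b))) s := by
    have h := (((hasDerivAt_pow 2 s).mul_const (γ * b)).div_const 2).cexp
    refine h.congr_deriv ?_
    push_cast
    ring
  have h := (he.div_const ((Real.sqrt n.factorial : ℂ) * (Real.sqrt k.factorial : ℂ))).mul
    (hasDerivAt_dispPoly γ b n k s)
  refine h.congr_deriv ?_
  rw [hb']
  simp only [dispFlow, ← hb]
  have hn := sqrt_factorial_ne_zero n
  have hk := sqrt_factorial_ne_zero k
  have e1 : γ * (Real.sqrt (k + 1 : ℝ) : ℂ) * (Complex.exp (s ^ 2 * (γ * b) / 2)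
      / ((Real.sqrt n.factorial : ℂ) * (Real.sqrt (k + 1).factorial : ℂ))
      * dispPoly (s * γ) (s * b) 1 n (k + 1)) =
      γ * (Complex.exp (s ^ 2 * (γ * b) / 2)
      / ((Real.sqrt n.factorial : ℂ) * (Real.sqrt k.factorial : ℂ))
      * dispPoly (s * γ) (s * b) 1 n (k + 1)) := by
    rw [sqrt_factorial_succ]
    have : (Real.sqrt (k + 1 : ℝ) : ℂ) ≠ 0 := by
      rw [Complex.ofReal_ne_zero, Real.sqrt_ne_zero']
      positivity
    field_simp
  have e2 : -b * (Real.sqrt (k : ℝ) : ℂ) * (Complex.exp (s ^ 2 * (γ * b) / 2)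
      / ((Real.sqrt n.factorial : ℂ) * (Real.sqrt (k - 1).factorial : ℂ))
      * dispPoly (s * γ) (s * b) 1 n (k - 1)) =
      -b * k * (Complex.exp (s ^ 2 * (γ * b) / 2)
      / ((Real.sqrt n.factorial : ℂ) * (Real.sqrt k.factorial : ℂ))
      * dispPoly (s * γ) (s * b) 1 n (k - 1)) := by
    rcases k with _ | k
    · simp
    · have h2 := ofReal_sqrt_mul_self (x := (k + 1 : ℝ)) (by positivity)
      have h3 := sqrt_factorial_ne_zero k
      have h4 : (Real.sqrt (k + 1 : ℝ) : ℂ) ≠ 0 := by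
        rw [Complex.ofReal_ne_zero, Real.sqrt_ne_zero']
        positivity
      rw [Nat.add_sub_cancel, sqrt_factorial_succ]
      push_cast at h2 ⊢
      rw [← h2]
      field_simp
  rw [e1, e2, dispPoly_succ_right]
  field_simp
  ring

/-- The `n`-th component of `exp(s (γ a† - γ* a)) v`. -/
def dispFlowLin (γ : ℂ) (n : ℕ) (s : ℂ) : (ℕ →₀ ℂ) →ₗ[ℂ] ℂ :=
  Finsupp.linearCombination ℂ fun k => dispFlow γ n k s

theorem hasDerivAt_dispFlowLin (γ : ℂ) (n : ℕ) (v : ℕ →₀ ℂ) (s : ℂ) :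
    HasDerivAt (fun s => dispFlowLin γ n s v) (dispFlowLin γ n s (dispGen γ v)) s := by
  induction v using Finsupp.induction_linear with
  | zero => simpa using hasDerivAt_const s (0 : ℂ)
  | add u v hu hv =>
    simp only [map_add]
    exact hu.add hv
  | single k c =>
    have h : Finsupp.single k c = c • Finsupp.single k (1 : ℂ) := by simp
    rw [h]
    simp only [map_smul, dispGen_single, map_sub, smul_eq_mul]
    refine HasDerivAt.const_mul c ?_
    simp only [dispFlowLin, Finsupp.linearCombination_single, one_smul]
    exact hasDerivAt_dispFlow γ n k s

theorem dispFlowLin_zero (γ : ℂ) (n : ℕ) (v : ℕ →₀ ℂ) : dispFlowLin γ n 0 v = v n := by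
  simp [dispFlowLin, Finsupp.linearCombination_apply, dispFlow_zero, eq_comm]

theorem iteratedDeriv_dispFlowLin (γ : ℂ) (n j : ℕ) (v : ℕ →₀ ℂ) :
    iteratedDeriv j (fun s => dispFlowLin γ n s v)
      = fun s => dispFlowLin γ n s ((dispGen γ ^ j) v) := by
  induction j generalizing v with
  | zero => simp
  | succ j ih =>
    rw [iteratedDeriv_succ', funext fun s => (hasDerivAt_dispFlowLin γ n v s).deriv, ih, pow_succ]
    rfl

theorem dispFlow_one (γ : ℂ) (n k : ℕ) : dispFlow γ n k 1 = dispCoeff γ n k := by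
  simp only [dispFlow, dispCoeff, one_mul, one_pow]
  congr 3
  rw [mul_neg, Complex.mul_conj, Complex.normSq_eq_norm_sq]
  push_cast
  ring_nf

/-- The flow is entire in `s`, and its `j`-th derivative at `0` is the `n`-th coordinate of `G^j
|k⟩`; the claim is its Taylor expansion at `s = 1`. -/
theorem hasSum_dispGen_pow (γ : ℂ) (n k : ℕ) :
    HasSum (fun j : ℕ => ((j.factorial : ℂ)⁻¹) * ((dispGen γ ^ j) (Finsupp.single k 1)) n)
      (dispCoeff γ n k) := by
  have hd : Differentiable ℂ (fun s => dispFlowLin γ n s (Finsupp.single k 1)) :=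
    fun s => (hasDerivAt_dispFlowLin γ n _ s).differentiableAt
  have h := Complex.hasSum_taylorSeries_of_entire hd 0 1
  refine h.of_eq (fun j => ?_) ?_
  · rw [iteratedDeriv_dispFlowLin]
    simp [dispFlowLin_zero]
  · simp [dispFlowLin, dispFlow_one]

theorem norm_ket (n : ℕ) : ‖(ket n : Mode)‖ = 1 := by
  rw [ket, lp.norm_single (by norm_num)]
  simp

/-- A finite superposition of number states as a vector of the mode. -/
def finKet : (ℕ →₀ ℂ) →ₗ[ℂ] Mode := Finsupp.linearCombination ℂ fun n : ℕ => (ket n : Mode)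

theorem finKet_apply (v : ℕ →₀ ℂ) (n : ℕ) : finKet v n = v n := by
  induction v using Finsupp.induction_linear with
  | zero => simp
  | add u v hu hv => simp [hu, hv]
  | single k c =>
    by_cases h : n = k
    · subst h
      simp [finKet, ket]
    · simp [finKet, ket, h]

/-- Each application of the generator to `|k⟩` yields two number states with coefficients at most
`‖γ‖ √(k+1)`, and raises the photon number by at most one. The lowering branch obeys the bound of
the raising branch by monotonicity. -/
theorem norm_finKet_dispGen_pow_le (γ : ℂ) (j k : ℕ) :
    ‖finKet ((dispGen γ ^ j) (Finsupp.single k 1))‖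
      ≤ ∏ i ∈ Finset.range j, (2 * ‖γ‖ * Real.sqrt (k + i + 1)) := by
  induction j generalizing k with
  | zero => simp [finKet, norm_ket]
  | succ j ih =>
    have hp : ∀ m : ℕ, 0 ≤ ∏ i ∈ Finset.range j, (2 * ‖γ‖ * Real.sqrt (m + i + 1)) :=
      fun m => Finset.prod_nonneg fun i _ => by positivity
    have hmono : ∏ i ∈ Finset.range j, (2 * ‖γ‖ * Real.sqrt ((k - 1 : ℕ) + i + 1))
        ≤ ∏ i ∈ Finset.range j, (2 * ‖γ‖ * Real.sqrt ((k + 1 : ℕ) + i + 1)) := by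
      refine Finset.prod_le_prod (fun i _ => by positivity) fun i _ => ?_
      gcongr
      omega
    rw [pow_succ, Module.End.mul_apply, dispGen_single]
    simp only [map_sub, map_smul]
    refine (norm_sub_le _ _).trans ?_
    rw [norm_smul, norm_smul, norm_mul, norm_mul, RCLike.norm_conj, Complex.norm_real,
      Complex.norm_real, Real.norm_of_nonneg (Real.sqrt_nonneg _),
      Real.norm_of_nonneg (Real.sqrt_nonneg _), Finset.prod_range_succ']
    have h1 := ih (k + 1)
    have h2 := (ih (k - 1)).trans hmono
    have hs : Real.sqrt (k : ℝ) ≤ Real.sqrt (k + 1 : ℝ) := Real.sqrt_le_sqrt (by linarith)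
    calc _ ≤ ‖γ‖ * Real.sqrt (k + 1 : ℝ) *
          (∏ i ∈ Finset.range j, (2 * ‖γ‖ * Real.sqrt ((k + 1 : ℕ) + i + 1)))
          + ‖γ‖ * Real.sqrt (k + 1 : ℝ) *
          (∏ i ∈ Finset.range j, (2 * ‖γ‖ * Real.sqrt ((k + 1 : ℕ) + i + 1))) := by
          gcongr
      _ = _ := by
          push_cast
          simp only [add_zero]
          rw [Finset.prod_congr rfl fun i _ => by
            rw [show (k + 1 + i + 1 : ℝ) = k + (i + 1) + 1 by ring]]
          ring

theorem summable_prod_sqrt_div_factorial {c : ℝ} (hc : 0 ≤ c) (k : ℕ) :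
    Summable fun j : ℕ => (j.factorial : ℝ)⁻¹ * ∏ i ∈ Finset.range j, (c * Real.sqrt (k + i + 1)) := by
  refine summable_of_ratio_norm_eventually_le (r := 1 / 2) (by norm_num) ?_
  -- For such `j`, `c² (k+j+1) ≤ c² (2j+1) ≤ j (2j+1)/8 ≤ ((j+1)/2)²`, so the ratio of consecutive
  -- terms is at most `1/2`.
  filter_upwards [Filter.eventually_ge_atTop k, Filter.eventually_ge_atTop ⌈8 * c ^ 2⌉₊] with j h1 h2
  have h3 : 8 * c ^ 2 ≤ j := Nat.ceil_le.1 h2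
  have h1' : (k : ℝ) ≤ j := by exact_mod_cast h1
  have hP : 0 ≤ ∏ i ∈ Finset.range j, (c * Real.sqrt (k + i + 1)) :=
    Finset.prod_nonneg fun i _ => by positivity
  rw [Real.norm_of_nonneg (mul_nonneg (by positivity)
    (Finset.prod_nonneg fun i _ => by positivity)), Real.norm_of_nonneg (by positivity),
    Finset.prod_range_succ, Nat.factorial_succ]
  have hX : c * Real.sqrt (k + j + 1) ≤ 1 / 2 * (j + 1) := by
    refine le_of_sq_le_sq ?_ (by positivity)
    rw [mul_pow, Real.sq_sqrt (by positivity)]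
    nlinarith [sq_nonneg c]
  push_cast
  rw [mul_inv]
  calc _ = ((j + 1 : ℝ)⁻¹ * (c * Real.sqrt (k + j + 1))) * ((j.factorial : ℝ)⁻¹
        * ∏ i ∈ Finset.range j, (c * Real.sqrt (k + i + 1))) := by ring
    _ ≤ ((j + 1 : ℝ)⁻¹ * (1 / 2 * (j + 1))) * ((j.factorial : ℝ)⁻¹
        * ∏ i ∈ Finset.range j, (c * Real.sqrt (k + i + 1))) := by gcongr
    _ = _ := by field_simp

theorem summable_dispGen_pow (γ : ℂ) (k : ℕ) :
    Summable fun j : ℕ => ((j.factorial : ℂ)⁻¹) • finKet ((dispGen γ ^ j) (Finsupp.single k 1)) := by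
  refine Summable.of_norm_bounded
    (summable_prod_sqrt_div_factorial (c := 2 * ‖γ‖) (by positivity) k) fun j => ?_
  rw [norm_smul, norm_inv, Complex.norm_natCast]
  gcongr
  exact norm_finKet_dispGen_pow_le γ j k

theorem ket_inner {κ : Type} [DecidableEq κ] (m : κ) (v : L2 κ) :
    inner ℂ (ket m) v = v m := by
  rw [ket, lp.inner_single_left]
  simp

/-- Norm convergence allows a coordinate to be taken termwise; the resulting scalar series is the
Taylor series already summed. -/
theorem displacedKet_apply (γ : ℂ) (k n : ℕ) : displacedKet γ k n = dispCoeff γ n k := by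
  have h := (summable_dispGen_pow γ k).hasSum.mapL (innerSL ℂ (ket n : Mode))
  refine HasSum.unique ?_ (hasSum_dispGen_pow γ n k)
  refine h.of_eq (fun j => ?_) ?_
  · simp [ket_inner, finKet_apply]
  · rw [innerSL_apply_apply, ket_inner]
    rfl

/-! ### Incomplete gamma functions and binomial averages -/

/-- `e^{-x} ∑_{i ≤ j} xⁱ/i!`, the probability that a Poisson variable of mean `x` is at most `j`. -/
def poissonTail (j : ℕ) (x : ℝ) : ℝ :=
  Real.exp (-x) * ∑ i ∈ Finset.range (j + 1), x ^ i / i.factorial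

/-- Differentiating the exponential and the partial sum telescopes to the top term. Thus the Poisson
probability is, up to sign and `j!`, an antiderivative of the incomplete gamma integrand. -/
theorem hasDerivAt_poissonTail (j : ℕ) (x : ℝ) :
    HasDerivAt (poissonTail j) (-(x ^ j / j.factorial * Real.exp (-x))) x := by
  have hsum : HasDerivAt (fun x : ℝ => ∑ i ∈ Finset.range (j + 1), x ^ i / i.factorial)
      (∑ i ∈ Finset.range j, x ^ i / i.factorial) x := by
    have h := HasDerivAt.fun_sum (u := Finset.range (j + 1)) (x := x)
      (A := fun i (x : ℝ) => x ^ i / i.factorial)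
      (fun i _ => (hasDerivAt_pow i x).div_const (i.factorial : ℝ))
    refine h.congr_deriv ?_
    rw [Finset.sum_range_succ']
    simp only [Nat.cast_zero, zero_mul, zero_div, add_zero, Nat.add_sub_cancel]
    refine Finset.sum_congr rfl fun i _ => ?_
    rw [Nat.factorial_succ]
    have : (i.factorial : ℝ) ≠ 0 := by positivity
    have : (i + 1 : ℝ) ≠ 0 := by positivity
    push_cast
    field_simp
  have h := ((hasDerivAt_neg x).exp).mul hsum
  refine h.congr_deriv ?_
  rw [Finset.sum_range_succ]
  ring

theorem tendsto_poissonTail (j : ℕ) :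
    Filter.Tendsto (poissonTail j) Filter.atTop (nhds 0) := by
  have h : ∀ i ∈ Finset.range (j + 1), Filter.Tendsto
      (fun x : ℝ => x ^ i * Real.exp (-x) / i.factorial) Filter.atTop (nhds 0) := fun i _ => by
    simpa using (Real.tendsto_pow_mul_exp_neg_atTop_nhds_zero i).div_const (i.factorial : ℝ)
  have h2 := tendsto_finsetSum _ h
  simp only [Finset.sum_const_zero] at h2
  refine h2.congr fun x => ?_
  rw [poissonTail, Finset.mul_sum]
  exact Finset.sum_congr rfl fun i _ => by ring

theorem upperGamma_eq (j : ℕ) {x : ℝ} (hx : 0 ≤ x) :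
    upperGamma (j + 1) x = j.factorial * poissonTail j x := by
  have hj : (j.factorial : ℝ) ≠ 0 := by positivity
  have h := integral_Ioi_of_hasDerivAt_of_nonpos' (a := x)
    (fun y _ => hasDerivAt_poissonTail j y)
    (fun y hy => by
      have : 0 ≤ y := hx.trans (le_of_lt hy)
      have : 0 ≤ y ^ j / j.factorial * Real.exp (-y) := by positivity
      linarith) (tendsto_poissonTail j)
  rw [integral_neg] at h
  have h2 : upperGamma (j + 1) x
      = ∫ y in Set.Ioi x, (j.factorial : ℝ) * (y ^ j / j.factorial * Real.exp (-y)) := by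
    rw [upperGamma]
    congr 1
    funext y
    rw [add_sub_cancel_right, Real.rpow_natCast]
    field_simp
  rw [h2, integral_const_mul]
  congr 1
  linarith

theorem poissonTail_zero (j : ℕ) : poissonTail j 0 = 1 := by
  simp [poissonTail, Finset.sum_range_succ']

theorem poissonTail_pos (j : ℕ) {x : ℝ} (hx : 0 ≤ x) : 0 < poissonTail j x := by
  rw [poissonTail, Finset.sum_range_succ']
  have : 0 ≤ ∑ i ∈ Finset.range j, x ^ (i + 1) / (i + 1).factorial :=
    Finset.sum_nonneg fun i _ => by positivity
  have h2 := Real.exp_pos (-x)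
  refine mul_pos h2 ?_
  simp
  linarith

theorem poissonTail_lt_one (j : ℕ) {x : ℝ} (hx : 0 < x) : poissonTail j x < 1 := by
  have h := Real.sum_le_exp_of_nonneg hx.le (j + 2)
  rw [Finset.sum_range_succ] at h
  have h2 : 0 < x ^ (j + 1) / (j + 1).factorial := by positivity
  rw [poissonTail, Real.exp_neg, inv_mul_lt_iff₀ (Real.exp_pos x), mul_one]
  linarith

theorem poissonTail_le_succ (j : ℕ) {x : ℝ} (hx : 0 ≤ x) :
    poissonTail j x ≤ poissonTail (j + 1) x := by
  rw [poissonTail, poissonTail, Finset.sum_range_succ _ (j + 1)]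
  have h2 : 0 ≤ x ^ (j + 1) / (j + 1).factorial := by positivity
  gcongr
  linarith

/-- The mean of `f` under the binomial distribution with parameters `n` and `τ`. -/
def binomMean (τ : ℝ) (n : ℕ) (f : ℕ → ℝ) : ℝ :=
  ∑ j ∈ Finset.range (n + 1), (n.choose j : ℝ) * τ ^ j * (1 - τ) ^ (n - j) * f j

theorem binomMean_one (τ : ℝ) (n : ℕ) : binomMean τ n (fun _ => 1) = 1 := by
  have h := add_pow τ (1 - τ) n
  rw [add_sub_cancel, one_pow] at h
  refine Eq.trans (Finset.sum_congr rfl fun j _ => ?_) h.symm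
  ring

theorem binomMean_mono {τ : ℝ} (h0 : 0 ≤ τ) (h1 : τ ≤ 1) (n : ℕ) {f g : ℕ → ℝ}
    (hfg : ∀ j, f j ≤ g j) : binomMean τ n f ≤ binomMean τ n g := by
  have := sub_nonneg.2 h1
  refine Finset.sum_le_sum fun j _ => ?_
  have := hfg j
  gcongr

theorem binomMean_strictMono {τ : ℝ} (h0 : 0 < τ) (h1 : τ ≤ 1) (n : ℕ) {f g : ℕ → ℝ}
    (hfg : ∀ j, f j < g j) : binomMean τ n f < binomMean τ n g := by
  have := sub_nonneg.2 h1
  -- The index `n` has weight `τ^n`, positive even when `τ = 1` kills all other weights.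
  refine Finset.sum_lt_sum (fun j _ => ?_) ⟨n, by simp, ?_⟩
  · have := (hfg j).le
    gcongr
  · have := hfg n
    simp only [Nat.choose_self, Nat.cast_one, one_mul, tsub_self, pow_zero, mul_one]
    gcongr

/-- Condition on one of the `n + 1` Bernoulli trials; algebraically, Pascal's rule. -/
theorem binomMean_succ (τ : ℝ) (n : ℕ) (f : ℕ → ℝ) :
    binomMean τ (n + 1) f = binomMean τ n fun j => (1 - τ) * f j + τ * f (j + 1) := by
  have e : ∀ (m : ℕ) (g : ℕ → ℝ), binomMean τ m g =
      ∑ ij ∈ Finset.HasAntidiagonal.antidiagonal m, (m.choose ij.1 : ℝ) * (τ ^ ij.1 * (1 - τ) ^ ij.2 * g ij.1) := by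
    intro m g
    rw [Finset.Nat.sum_antidiagonal_eq_sum_range_succ
      (fun i j => (m.choose i : ℝ) * (τ ^ i * (1 - τ) ^ j * g i)), binomMean]
    exact Finset.sum_congr rfl fun j _ => by ring
  rw [e, e, Finset.sum_antidiagonal_choose_succ_mul (fun i j => τ ^ i * (1 - τ) ^ j * f i),
    ← Finset.sum_add_distrib]
  refine Finset.sum_congr rfl fun ij hij => ?_
  have hc : n.choose ij.2 = n.choose ij.1 := by
    rw [← Finset.HasAntidiagonal.mem_antidiagonal.1 hij, add_comm, Nat.choose_symm_add, add_comm]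
  rw [hc]
  ring

theorem binomMean_le_succ {τ : ℝ} (h0 : 0 ≤ τ) (h1 : τ ≤ 1) (n : ℕ) {f : ℕ → ℝ}
    (hf : ∀ j, f j ≤ f (j + 1)) : binomMean τ n f ≤ binomMean τ (n + 1) f := by
  rw [binomMean_succ]
  refine binomMean_mono h0 h1 n fun j => ?_
  nlinarith [hf j]

/-- The eigenvalue `⟨n|V₁|n⟩` of the test operator of the nonideal detector. -/
def testWeight (η ν : ℝ) (n : ℕ) (β : ℝ) : ℝ :=
  binomMean (η / (1 + ν)) n fun j => poissonTail j (β ^ 2 / (1 + ν))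

theorem transmissivity_pos {η ν : ℝ} (hη : 0 < η) (hν : 0 ≤ ν) : 0 < η / (1 + ν) := by positivity

theorem transmissivity_le_one {η ν : ℝ} (hη1 : η ≤ 1) (hν : 0 ≤ ν) : η / (1 + ν) ≤ 1 := by
  rw [div_le_one (by positivity)]
  linarith

theorem testWeight_pos {η ν : ℝ} (hη : 0 < η) (hη1 : η ≤ 1) (hν : 0 ≤ ν)
    (n : ℕ) (β : ℝ) : 0 < testWeight η ν n β := by
  have h := binomMean_strictMono (transmissivity_pos hη hν) (transmissivity_le_one hη1 hν) n
    (f := fun _ => 0) (g := fun j => poissonTail j (β ^ 2 / (1 + ν)))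
    (fun j => poissonTail_pos j (by positivity))
  simpa [testWeight, binomMean] using h

/-- Strictness comes from `β > 0` and ensures `w / r < 1` even for `w = 1`, as the Chernoff
parameter requires. -/
theorem testWeight_lt_one {η ν : ℝ} (hη : 0 < η) (hη1 : η ≤ 1) (hν : 0 ≤ ν)
    (n : ℕ) {β : ℝ} (hβ : 0 < β) : testWeight η ν n β < 1 := by
  rw [← binomMean_one (η / (1 + ν)) n]
  exact binomMean_strictMono (transmissivity_pos hη hν) (transmissivity_le_one hη1 hν) n
    fun j => poissonTail_lt_one j (by positivity)

/-- One more photon is one more Bernoulli trial, and the Poisson probability grows with the number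
of successes. This monotonicity is what makes the eigenvalue at `nc` a lower bound for `V₁` on the
whole tail. -/
theorem testWeight_mono {η ν : ℝ} (hη : 0 < η) (hη1 : η ≤ 1) (hν : 0 ≤ ν)
    (β : ℝ) : Monotone fun n => testWeight η ν n β :=
  monotone_nat_of_le_succ fun n => binomMean_le_succ (transmissivity_pos hη hν).le
    (transmissivity_le_one hη1 hν) n fun j => poissonTail_le_succ j (by positivity)

theorem rNonideal_eq {η ν : ℝ} (hν : 0 ≤ ν)
    (n : ℕ) (β : ℝ) : rNonideal η ν n β = (testWeight η ν n β)⁻¹ := by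
  rw [rNonideal, testWeight, binomMean]
  congr 1
  refine Finset.sum_congr rfl fun j _ => ?_
  rw [upperGamma_eq j (by positivity), upperGamma_eq j le_rfl, poissonTail_zero]
  have : (j.factorial : ℝ) ≠ 0 := by positivity
  field_simp

theorem testWeight_zero (η ν : ℝ) (n : ℕ) : testWeight η ν n 0 = 1 := by
  simp [testWeight, poissonTail_zero, binomMean_one]

/-- At `τ = 1` the factor `0^(n-j)` leaves only `j = n`. -/
theorem rNonideal_one_zero (n : ℕ) (β : ℝ) : rNonideal 1 0 n β = rIdeal n β := by
  rw [rNonideal, rIdeal, Finset.sum_range_succ, Finset.sum_eq_zero]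
  · simp
  · intro j hj
    have : n - j ≠ 0 := by have := Finset.mem_range.1 hj; omega
    simp [this]

/-- The radial outcome density of the nonideal detector in the number state `n`, times `π`. -/
def radialDensity (η ν : ℝ) (n : ℕ) (r : ℝ) : ℝ :=
  (1 + ν)⁻¹ * binomMean (η / (1 + ν)) n fun j =>
    (r ^ 2 / (1 + ν)) ^ j / j.factorial * Real.exp (-(r ^ 2 / (1 + ν)))

theorem radialDensity_nonneg {η ν : ℝ} (hη : 0 < η) (hη1 : η ≤ 1) (hν : 0 ≤ ν) (n : ℕ) (r : ℝ) :
    0 ≤ radialDensity η ν n r := by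
  have h := binomMean_mono (transmissivity_pos hη hν).le (transmissivity_le_one hη1 hν) n
    (f := fun _ => 0) (g := fun j => (r ^ 2 / (1 + ν)) ^ j / j.factorial *
      Real.exp (-(r ^ 2 / (1 + ν)))) (fun j => by positivity)
  refine mul_nonneg (by positivity) ?_
  simpa [binomMean] using h

/-- The factor `2 r` comes from substituting `x = r²/(1+ν)` in the Poisson derivative; it matches
the Jacobian of polar coordinates, so the radial integral is elementary. -/
theorem hasDerivAt_testWeight (η ν : ℝ) (n : ℕ) (r : ℝ) :
    HasDerivAt (testWeight η ν n) (-(2 * r * radialDensity η ν n r)) r := by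
  have h1 : HasDerivAt (fun r : ℝ => r ^ 2 / (1 + ν)) (2 * r / (1 + ν)) r := by
    simpa using (hasDerivAt_pow 2 r).div_const (1 + ν)
  have h := HasDerivAt.fun_sum (u := Finset.range (n + 1)) (x := r)
    (fun j _ => (((hasDerivAt_poissonTail j (r ^ 2 / (1 + ν))).comp r h1).const_mul
      ((n.choose j : ℝ) * (η / (1 + ν)) ^ j * (1 - (η / (1 + ν))) ^ (n - j))))
  refine h.congr_deriv ?_
  rw [radialDensity, binomMean, Finset.mul_sum, Finset.mul_sum, ← Finset.sum_neg_distrib]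
  exact Finset.sum_congr rfl fun j _ => by ring

theorem tendsto_testWeight (η : ℝ) {ν : ℝ} (hν : 0 ≤ ν) (n : ℕ) :
    Filter.Tendsto (testWeight η ν n) Filter.atTop (nhds 0) := by
  have h1 : Filter.Tendsto (fun r : ℝ => r ^ 2 / (1 + ν)) Filter.atTop Filter.atTop :=
    (Filter.tendsto_pow_atTop two_ne_zero).atTop_div_const (by positivity)
  have h := tendsto_finsetSum (Finset.range (n + 1)) fun j _ =>
    ((tendsto_poissonTail j).comp h1).const_mul
      ((n.choose j : ℝ) * (η / (1 + ν)) ^ j * (1 - (η / (1 + ν))) ^ (n - j))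
  simp only [mul_zero, Finset.sum_const_zero] at h
  exact h

theorem lintegral_radialDensity {η ν : ℝ} (hη : 0 < η) (hη1 : η ≤ 1) (hν : 0 ≤ ν) (n : ℕ) {β : ℝ}
    (hβ : 0 ≤ β) :
    ∫⁻ r in Set.Ioi β, ENNReal.ofReal (2 * r * radialDensity η ν n r)
      = ENNReal.ofReal (testWeight η ν n β) := by
  have hnn : ∀ r ∈ Set.Ioi β, 0 ≤ 2 * r * radialDensity η ν n r := fun r hr => by
    have := radialDensity_nonneg hη hη1 hν n r
    have : 0 ≤ r := hβ.trans (le_of_lt hr)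
    positivity
  have hint := integrableOn_Ioi_deriv_of_nonpos' (a := β)
    (fun r _ => hasDerivAt_testWeight η ν n r) (fun r hr => neg_nonpos.2 (hnn r hr))
    (tendsto_testWeight η hν n)
  have h := integral_Ioi_of_hasDerivAt_of_tendsto'
    (fun r _ => hasDerivAt_testWeight η ν n r) hint (tendsto_testWeight η hν n)
  rw [integral_neg] at h
  have hint' : IntegrableOn (fun r => 2 * r * radialDensity η ν n r) (Set.Ioi β) := by
    simpa using hint.neg
  rw [← ofReal_integral_eq_lintegral_ofReal hint'
    ((ae_restrict_iff' measurableSet_Ioi).2 (Filter.Eventually.of_forall hnn))]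
  congr 1
  linarith

/-! ### Displacement matrix elements -/

theorem dispCoeff_rotate (z : ℂ) (hz : ‖z‖ = 1) (r : ℝ) (n k : ℕ) :
    dispCoeff (r * z) n k * z ^ k = z ^ n * dispCoeff r n k := by
  have hzz : z * starRingEnd ℂ z = 1 := by
    rw [Complex.mul_conj, Complex.normSq_eq_norm_sq, hz]
    simp
  have h := dispPoly_rotate (r : ℂ) (-(r : ℂ)) 1 hzz n k
  have e1 : (r : ℂ) * z = z * r := mul_comm _ _
  have e2 : -(starRingEnd ℂ (r * z)) = starRingEnd ℂ z * -(r : ℂ) := by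
    rw [map_mul, Complex.conj_ofReal]
    ring
  rw [dispCoeff, dispCoeff, e2, e1, norm_mul, hz, one_mul, Complex.conj_ofReal, mul_assoc, h]
  ring

theorem norm_dispCoeff_rotate (z : ℂ) (hz : ‖z‖ = 1) (r : ℝ) (n k : ℕ) :
    ‖dispCoeff (r * z) n k‖ = ‖dispCoeff r n k‖ := by
  have h := congrArg norm (dispCoeff_rotate z hz r n k)
  simpa [norm_mul, norm_pow, hz] using h

theorem norm_sq_dispCoeff_ofReal (r : ℝ) (n k : ℕ) :
    ‖dispCoeff r n k‖ ^ 2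
      = Real.exp (-r ^ 2) / (n.factorial * k.factorial) * dispPoly r (-r) 1 n k ^ 2 := by
  have h : dispPoly (r : ℂ) (-(starRingEnd ℂ (r : ℂ))) 1 n k = (dispPoly r (-r) 1 n k : ℝ) := by
    have := dispPoly_map r (-r) 1 Complex.ofRealHom n k
    simpa using this
  rw [dispCoeff, h, norm_mul, norm_div, norm_mul]
  simp only [Complex.norm_real]
  rw [mul_pow, div_pow, mul_pow]
  simp only [Real.norm_eq_abs, sq_abs]
  rw [Real.sq_sqrt (by positivity), Real.sq_sqrt (by positivity), ← Real.exp_nat_mul]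
  congr 3
  push_cast
  ring

/-- The generating function at `a = r`, `b = -r`: the shifted argument is `a + q b = (1-q) r`, and
the two exponentials combine to `exp(-(1-q) r²)`. The explicit sum is reflected, `j ↦ n - j`, to
expose binomial weights. -/
theorem hasSum_norm_sq_dispCoeff (r q : ℝ) (n : ℕ) :
    HasSum (fun k : ℕ => q ^ k * ‖dispCoeff r n k‖ ^ 2)
      (Real.exp (-((1 - q) * r ^ 2)) * ∑ j ∈ Finset.range (n + 1),
        (n.choose j : ℝ) * q ^ (n - j) * ((1 - q) * r) ^ (2 * j) / j.factorial) := by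
  refine ((hasSum_dispPoly_mul r (-r) q n n).mul_left
    (Real.exp (-r ^ 2) / n.factorial)).of_eq (fun k => ?_) ?_
  · rw [norm_sq_dispCoeff_ofReal]
    have : (n.factorial : ℝ) ≠ 0 := by positivity
    have : (k.factorial : ℝ) ≠ 0 := by positivity
    field_simp
  · rw [dispPoly_eq_sum, ← Finset.sum_range_reflect, Finset.mul_sum, Finset.mul_sum,
      Finset.mul_sum]
    refine Finset.sum_congr rfl fun j hj => ?_
    have hj' : j ≤ n := Nat.lt_succ_iff.1 (Finset.mem_range.1 hj)
    have h1 : n + 1 - 1 - j = n - j := rfl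
    have h2 : Real.exp (-((1 - q) * r ^ 2)) = Real.exp (-r ^ 2) * Real.exp (q * (-r) ^ 2) := by
      rw [← Real.exp_add]
      congr 1
      ring
    have h3 : (n.choose j : ℝ) * (j.factorial : ℝ) * ((n - j).factorial : ℝ) = n.factorial := by
      exact_mod_cast Nat.choose_mul_factorial_mul_factorial hj'
    rw [h1, h2, Nat.choose_symm hj', Nat.sub_sub_self hj', ← h3]
    have : (j.factorial : ℝ) ≠ 0 := by positivity
    have : ((n - j).factorial : ℝ) ≠ 0 := by positivity
    have : (n.choose j : ℝ) ≠ 0 := by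
      exact_mod_cast (Nat.choose_pos hj').ne'
    field_simp
    ring

/-- Displacements preserve norms: swapping the indices and taking `q = 1` gives `a + q b = 0`, where
the polynomial is `k!`. -/
theorem hasSum_norm_sq_dispCoeff_left (γ : ℂ) (k : ℕ) :
    HasSum (fun n : ℕ => ‖dispCoeff γ n k‖ ^ 2) 1 := by
  have hr : ∀ n, ‖dispCoeff γ n k‖ = ‖dispCoeff (‖γ‖ : ℂ) n k‖ := fun n => by
    by_cases h : γ = 0
    · simp [h]
    · have h' : (‖γ‖ : ℂ) ≠ 0 := by simpa using h
      have := norm_dispCoeff_rotate (γ / ‖γ‖) (by simp [h]) ‖γ‖ n k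
      rwa [mul_div_cancel₀ _ h'] at this
  have h := (hasSum_dispPoly_mul (-‖γ‖) ‖γ‖ 1 k k).mul_left (Real.exp (-‖γ‖ ^ 2) / k.factorial)
  refine h.of_eq (fun n => ?_) ?_
  · rw [hr, norm_sq_dispCoeff_ofReal, dispPoly_comm]
    have : (n.factorial : ℝ) ≠ 0 := by positivity
    have : (k.factorial : ℝ) ≠ 0 := by positivity
    field_simp
    simp
  · have : (k.factorial : ℝ) ≠ 0 := by positivity
    rw [one_mul, one_mul, neg_add_cancel, dispPoly_zero_zero, if_pos rfl, div_mul_eq_mul_div,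
      eq_div_iff this, ← mul_assoc, ← Real.exp_add]
    simp

/-- The weight of the `k`-th displaced number state in the POVM density. -/
def povmCoeff (η ν : ℝ) (k : ℕ) : ℝ :=
  1 / (η * Real.pi) * (((1 - η + ν) / η) ^ k / (1 + (1 - η + ν) / η) ^ (k + 1))

/-- With `n̄ = (1-η+ν)/η` the thermal ratio `n̄/(1+n̄)` equals `1 - τ`, and `η (1+n̄) = 1 + ν`. -/
theorem povmCoeff_eq {η ν : ℝ} (hη : 0 < η) (hν : 0 ≤ ν) (k : ℕ) :
    povmCoeff η ν k = (Real.pi * (1 + ν))⁻¹ * (1 - η / (1 + ν)) ^ k := by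
  have h1 : 1 + (1 - η + ν) / η = (1 + ν) / η := by field_simp; ring
  have h2 : 1 - η / (1 + ν) = ((1 - η + ν) / η) / ((1 + ν) / η) := by
    field_simp
    ring
  rw [povmCoeff, h1, h2, div_pow _ ((1 + ν) / η), pow_succ]
  have := Real.pi_pos
  field_simp

theorem povmCoeff_nonneg {η ν : ℝ} (hη : 0 < η) (hη1 : η ≤ 1) (hν : 0 ≤ ν) (k : ℕ) :
    0 ≤ povmCoeff η ν k := by
  have := sub_nonneg.2 (transmissivity_le_one hη1 hν)
  have := Real.pi_pos
  rw [povmCoeff_eq hη hν]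
  positivity

theorem hasSum_povmCoeff_mul {η ν : ℝ} (hη : 0 < η) (hν : 0 ≤ ν) (n : ℕ) (r : ℝ) :
    HasSum (fun k : ℕ => povmCoeff η ν k * ‖dispCoeff ((r / Real.sqrt η : ℝ) : ℂ) n k‖ ^ 2)
      (radialDensity η ν n r / Real.pi) := by
  refine ((hasSum_norm_sq_dispCoeff (r / Real.sqrt η) (1 - η / (1 + ν)) n).mul_left
    (Real.pi * (1 + ν))⁻¹).of_eq (fun k => ?_) ?_
  · rw [povmCoeff_eq hη hν]
    ring
  · rw [radialDensity, binomMean, Finset.mul_sum, Finset.mul_sum, Finset.mul_sum, Finset.sum_div]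
    refine Finset.sum_congr rfl fun j _ => ?_
    have hs : (r / Real.sqrt η) ^ 2 = r ^ 2 / η := by rw [div_pow, Real.sq_sqrt hη.le]
    have e1 : (1 - (1 - η / (1 + ν))) * (r / Real.sqrt η) ^ 2 = r ^ 2 / (1 + ν) := by
      rw [hs]
      field_simp
      ring
    have e2 : ((1 - (1 - η / (1 + ν))) * (r / Real.sqrt η)) ^ (2 * j)
        = (η / (1 + ν)) ^ j * (r ^ 2 / (1 + ν)) ^ j := by
      rw [pow_mul, mul_pow, hs, ← mul_pow]
      congr 1
      field_simp
      ring
    rw [e1, e2]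
    have := Real.pi_pos
    field_simp

/-! ### Parseval's identity on the circle -/

theorem integral_exp_int_mul (d : ℤ) :
    ∫ θ in -Real.pi..Real.pi, Complex.exp (d * Complex.I * θ)
      = if d = 0 then (2 * Real.pi : ℂ) else 0 := by
  by_cases h : d = 0
  · subst h
    simp
    ring
  · rw [if_neg h, integral_exp_mul_complex (by simp [h]), div_eq_zero_iff]
    left
    have h2 : (d : ℂ) * Complex.I * (Real.pi : ℝ)
        = (d : ℂ) * Complex.I * ((-Real.pi : ℝ) : ℂ) + d * (2 * Real.pi * Complex.I) := by
      push_cast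
      ring
    rw [h2, Complex.exp_add, Complex.exp_int_mul_two_pi_mul_I, mul_one, sub_self]

theorem norm_exp_neg_I (θ : ℝ) (n : ℕ) : ‖Complex.exp (-(θ * Complex.I)) ^ n‖ = 1 := by
  rw [norm_pow, Complex.norm_exp]
  simp

/-- Absolute summability permits expanding the square into a double series and integrating termwise;
only the diagonal frequencies survive. -/
theorem lintegral_circle_enorm_sq {a : ℕ → ℂ} (ha : Summable fun n => ‖a n‖) :
    ∫⁻ θ in Set.Ioo (-Real.pi) Real.pi,
        ‖∑' n, a n * Complex.exp (-(θ * Complex.I)) ^ n‖ₑ ^ 2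
      = ENNReal.ofReal (2 * Real.pi) * ∑' n, ‖a n‖ₑ ^ 2 := by
  set f : ℝ → ℂ := fun θ => ∑' n, a n * Complex.exp (-(θ * Complex.I)) ^ n with hf
  have hnorm : ∀ (n : ℕ) (θ : ℝ), ‖a n * Complex.exp (-(θ * Complex.I)) ^ n‖ = ‖a n‖ :=
    fun n θ => by rw [norm_mul, norm_exp_neg_I, mul_one]
  have hfc : Continuous f := by
    refine continuous_tsum (fun n => by fun_prop) ha fun n θ => (hnorm n θ).le
  set F : ℕ × ℕ → ℝ → ℂ := fun p θ =>
    (a p.1 * starRingEnd ℂ (a p.2)) * Complex.exp (((p.2 - p.1 : ℤ) : ℂ) * Complex.I * θ) with hF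
  have hFf : ∀ θ, ∑' p, F p θ = ((‖f θ‖ ^ 2 : ℝ) : ℂ) := by
    intro θ
    have h1 : Summable fun n => ‖a n * Complex.exp (-(θ * Complex.I)) ^ n‖ := by
      simpa only [hnorm] using ha
    have h2 : Summable fun n => ‖starRingEnd ℂ (a n * Complex.exp (-(θ * Complex.I)) ^ n)‖ := by
      simpa only [RCLike.norm_conj] using h1
    rw [Complex.ofReal_pow, ← Complex.mul_conj', hf, Complex.conj_tsum,
      tsum_mul_tsum_of_summable_norm h1 h2]
    refine tsum_congr fun p => ?_
    simp only [hF, map_mul, ← Complex.exp_conj, ← Complex.exp_nat_mul]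
    rw [mul_mul_mul_comm, ← Complex.exp_add]
    congr 2
    simp
    ring
  have hFint : ∀ p, Integrable (F p) (volume.restrict (Set.Ioc (-Real.pi) Real.pi)) := fun p =>
    Continuous.integrableOn_Ioc (by fun_prop)
  have hFn : ∀ p θ, ‖F p θ‖ = ‖a p.1‖ * ‖a p.2‖ := fun p θ => by
    rw [hF, norm_mul, norm_mul, RCLike.norm_conj, Complex.norm_exp]
    simp
  have hsum : Summable fun p : ℕ × ℕ => ‖a p.1‖ * ‖a p.2‖ :=
    ha.mul_of_nonneg ha (fun _ => norm_nonneg _) fun _ => norm_nonneg _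
  have h := hasSum_integral_of_summable_integral_norm hFint (by
    simp only [hFn, integral_const, smul_eq_mul]
    exact hsum.mul_left _)
  simp only [hFf] at h
  have hval : ∀ p, ∫ θ in Set.Ioc (-Real.pi) Real.pi, F p θ
      = if p.1 = p.2 then ((2 * Real.pi * ‖a p.1‖ ^ 2 : ℝ) : ℂ) else 0 := by
    intro p
    have hpi : -Real.pi ≤ Real.pi := by linarith [Real.pi_pos]
    rw [← intervalIntegral.integral_of_le hpi, hF]
    simp only
    rw [intervalIntegral.integral_const_mul, integral_exp_int_mul]
    by_cases hp : p.1 = p.2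
    · rw [if_pos (by rw [hp, sub_self]), if_pos hp, ← hp, Complex.mul_conj']
      push_cast
      ring
    · rw [if_neg (by rw [sub_eq_zero]; exact_mod_cast Ne.symm hp), if_neg hp, mul_zero]
  simp only [hval] at h
  have hdiag : Function.Injective (fun n : ℕ => (n, n)) := fun m n h => (Prod.mk.inj h).1
  rw [← hdiag.hasSum_iff (by
    rintro ⟨m, n⟩ hmn
    refine if_neg fun e => hmn ⟨m, ?_⟩
    simpa using e)] at h
  simp only [Function.comp_def, if_true] at h
  rw [integral_complex_ofReal, Complex.hasSum_ofReal] at h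
  rw [restrict_Ioo_eq_restrict_Ioc]
  have h3 : ∀ θ, ‖f θ‖ₑ ^ 2 = ENNReal.ofReal (‖f θ‖ ^ 2) := fun θ => by
    rw [ENNReal.ofReal_pow (norm_nonneg _), ofReal_norm]
  change ∫⁻ θ in _, ‖f θ‖ₑ ^ 2 = _
  simp only [h3]
  rw [← ofReal_integral_eq_lintegral_ofReal (Continuous.integrableOn_Ioc (by fun_prop))
    (Filter.Eventually.of_forall fun θ => by positivity), ← h.tsum_eq,
    ENNReal.ofReal_tsum_of_nonneg (fun n => by positivity) h.summable, ← ENNReal.tsum_mul_left]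
  refine tsum_congr fun n => ?_
  rw [ENNReal.ofReal_mul (by positivity), ENNReal.ofReal_pow (norm_nonneg _), ofReal_norm]

/-! ### The test form in the number basis -/

theorem inner_eq_tsum_displacedKet (γ : ℂ) (k : ℕ) (ψ : Mode) :
    inner ℂ (displacedKet γ k) ψ = ∑' n, starRingEnd ℂ (dispCoeff γ n k) * ψ n := by
  rw [lp.inner_eq_tsum]
  refine tsum_congr fun n => ?_
  rw [displacedKet_apply, RCLike.inner_apply, mul_comm]

theorem summable_dispCoeff_mul (γ : ℂ) (k : ℕ) (ψ : Mode) :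
    Summable fun n => starRingEnd ℂ (dispCoeff γ n k) * ψ n := by
  refine (lp.summable_inner (𝕜 := ℂ) (displacedKet γ k) ψ).congr fun n => ?_
  rw [displacedKet_apply, RCLike.inner_apply, mul_comm]

/-- The outcome density `⟨ψ|G_y|ψ⟩` of the nonideal detector as an extended nonnegative number. -/
def povmForm (η ν : ℝ) (y : ℂ) (ψ : Mode) : ENNReal :=
  ∑' k : ℕ, ENNReal.ofReal (povmCoeff η ν k) *
    ‖inner ℂ (displacedKet (y / (Real.sqrt η : ℂ)) k) ψ‖ₑ ^ 2

theorem continuous_dispCoeff (n k : ℕ) : Continuous fun γ => dispCoeff γ n k := by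
  have h : ∀ k n, Continuous fun γ : ℂ => dispPoly γ (-(starRingEnd ℂ γ)) 1 n k := by
    intro k
    induction k with
    | zero =>
      intro n
      simp only [dispPoly_zero_right]
      fun_prop
    | succ k ih =>
      intro n
      simp only [dispPoly_succ_right]
      have h1 := ih n
      have h2 := ih (n - 1)
      have h3 : Continuous fun γ : ℂ => starRingEnd ℂ γ := Complex.continuous_conj
      fun_prop
  have := h k n
  unfold dispCoeff
  fun_prop

theorem measurable_inner_displacedKet (c : ℂ) (k : ℕ) (ψ : Mode) :
    Measurable fun y : ℂ => inner ℂ (displacedKet (y / c) k) ψ := by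
  refine measurable_of_tendsto_metrizable (f := fun N (y : ℂ) =>
    ∑ n ∈ Finset.range N, starRingEnd ℂ (dispCoeff (y / c) n k) * ψ n) (fun N => ?_)
    (tendsto_pi_nhds.2 fun y => ?_)
  · refine Continuous.measurable (continuous_finsetSum _ fun n _ => ?_)
    have h := (continuous_dispCoeff n k).comp (continuous_id.div_const c)
    exact (Complex.continuous_conj.comp h).mul continuous_const
  · rw [inner_eq_tsum_displacedKet]
    exact (summable_dispCoeff_mul (y / c) k ψ).hasSum.tendsto_sum_nat

theorem measurable_povmForm (η ν : ℝ) (ψ : Mode) : Measurable fun y => povmForm η ν y ψ :=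
  Measurable.tsum fun k =>
    ((measurable_inner_displacedKet _ k ψ).enorm.pow_const 2).const_mul _

/-- Phase covariance moves the angle into the Fourier factors `e^(-inθ)`; the remaining phase
depends only on `k` and has modulus one. -/
theorem enorm_inner_displacedKet_rotate (r θ : ℝ) (k : ℕ) (ψ : Mode) :
    ‖inner ℂ (displacedKet (r * Complex.exp (θ * Complex.I)) k) ψ‖ₑ
      = ‖∑' n, (starRingEnd ℂ (dispCoeff r n k) * ψ n) * Complex.exp (-(θ * Complex.I)) ^ n‖ₑ := by
  set z := Complex.exp (θ * Complex.I) with hz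
  have hz1 : ‖z‖ = 1 := Complex.norm_exp_ofReal_mul_I θ
  have hzc : starRingEnd ℂ z = Complex.exp (-(θ * Complex.I)) := by
    rw [hz, ← Complex.exp_conj]
    simp
  rw [inner_eq_tsum_displacedKet]
  have h : ∑' n, (starRingEnd ℂ (dispCoeff r n k) * ψ n) * Complex.exp (-(θ * Complex.I)) ^ n
      = starRingEnd ℂ z ^ k * ∑' n, starRingEnd ℂ (dispCoeff (r * z) n k) * ψ n := by
    rw [← tsum_mul_left]
    refine tsum_congr fun n => ?_
    have h1 := congrArg (starRingEnd ℂ) (dispCoeff_rotate z hz1 r n k)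
    simp only [map_mul, map_pow] at h1
    rw [← hzc]
    linear_combination -(ψ n) * h1
  rw [h, enorm_mul, enorm_pow]
  have : ‖starRingEnd ℂ z‖ₑ = 1 := by
    rw [← ofReal_norm, RCLike.norm_conj, hz1, ENNReal.ofReal_one]
  rw [this, one_pow, one_mul]

theorem lintegral_circle_povmForm {η ν : ℝ} (hη : 0 < η) (hη1 : η ≤ 1) (hν : 0 ≤ ν) (ψ : Mode)
    (r : ℝ) :
    ∫⁻ θ in Set.Ioo (-Real.pi) Real.pi, povmForm η ν (r * Complex.exp (θ * Complex.I)) ψ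
      = ∑' n, ENNReal.ofReal (2 * radialDensity η ν n r) * ‖ψ n‖ₑ ^ 2 := by
  have hc := povmCoeff_nonneg hη hη1 hν
  have e : ∀ θ : ℝ, (r * Complex.exp (θ * Complex.I)) / (Real.sqrt η : ℂ)
      = ((r / Real.sqrt η : ℝ) : ℂ) * Complex.exp (θ * Complex.I) := fun θ => by
    push_cast
    ring
  have hmeas : ∀ k, Measurable fun θ : ℝ => ENNReal.ofReal (povmCoeff η ν k) *
      ‖inner ℂ (displacedKet ((r * Complex.exp (θ * Complex.I)) / (Real.sqrt η : ℂ)) k) ψ‖ₑ ^ 2 :=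
    fun k => ((measurable_inner_displacedKet (Real.sqrt η : ℂ) k ψ).comp
      (g := fun y : ℂ => _) (f := fun θ : ℝ => r * Complex.exp (θ * Complex.I))
      (by fun_prop)).enorm.pow_const 2 |>.const_mul _
  simp only [povmForm]
  rw [lintegral_tsum fun k => (hmeas k).aemeasurable]
  have hk : ∀ k, ∫⁻ θ in Set.Ioo (-Real.pi) Real.pi, ENNReal.ofReal (povmCoeff η ν k) *
      ‖inner ℂ (displacedKet ((r * Complex.exp (θ * Complex.I)) / (Real.sqrt η : ℂ)) k) ψ‖ₑ ^ 2
      = ∑' n, ENNReal.ofReal (2 * Real.pi) * (ENNReal.ofReal (povmCoeff η ν k *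
        ‖dispCoeff ((r / Real.sqrt η : ℝ) : ℂ) n k‖ ^ 2) * ‖ψ n‖ₑ ^ 2) := by
    intro k
    rw [lintegral_const_mul' _ _ ENNReal.ofReal_ne_top]
    simp only [e, enorm_inner_displacedKet_rotate]
    rw [lintegral_circle_enorm_sq (summable_dispCoeff_mul _ k ψ).norm, ← mul_assoc,
      ← ENNReal.tsum_mul_left]
    refine tsum_congr fun n => ?_
    rw [enorm_mul, mul_pow, ENNReal.ofReal_mul (hc k), ENNReal.ofReal_pow (norm_nonneg _),
      ← RCLike.norm_conj, ofReal_norm]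
    ring
  simp only [hk]
  rw [ENNReal.tsum_comm]
  refine tsum_congr fun n => ?_
  rw [ENNReal.tsum_mul_left, ENNReal.tsum_mul_right, ← mul_assoc]
  congr 1
  have h := hasSum_povmCoeff_mul hη hν n r
  rw [← ENNReal.ofReal_tsum_of_nonneg (fun k => mul_nonneg (hc k) (by positivity)) h.summable,
    h.tsum_eq, ← ENNReal.ofReal_mul (by positivity)]
  congr 1
  have := Real.pi_pos
  field_simp

/-- In polar coordinates the angular integral diagonalizes the form and the radial one yields the
eigenvalues. The case `β = 0` is included because it gives the normalization of the outcome law. -/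
theorem lintegral_povmForm {η ν : ℝ} (hη : 0 < η) (hη1 : η ≤ 1) (hν : 0 ≤ ν) {β : ℝ} (hβ : 0 ≤ β)
    (ψ : Mode) :
    ∫⁻ y in {y : ℂ | β ≤ ‖y‖}, povmForm η ν y ψ
      = ∑' n, ENNReal.ofReal (testWeight η ν n β) * ‖ψ n‖ₑ ^ 2 := by
  have hS : MeasurableSet {y : ℂ | β ≤ ‖y‖} := measurableSet_le measurable_const measurable_norm
  have hm := measurable_povmForm η ν ψ
  have hpolar : ∀ p : ℝ × ℝ, Complex.polarCoord.symm p = p.1 * Complex.exp (p.2 * Complex.I) :=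
    fun p => by
      rw [Complex.polarCoord_symm_apply, Complex.exp_mul_I]
      push_cast
      rfl
  have hmp : Measurable fun p : ℝ × ℝ => (p.1 : ℂ) * Complex.exp (p.2 * Complex.I) := by fun_prop
  rw [← lintegral_indicator hS, ← Complex.lintegral_comp_polarCoord_symm, polarCoord_target,
    Measure.volume_eq_prod, ← Measure.prod_restrict, lintegral_prod]
  swap
  · refine Measurable.aemeasurable ?_
    simp only [hpolar, smul_eq_mul]
    exact (ENNReal.measurable_ofReal.comp measurable_fst).mul ((hm.indicator hS).comp hmp)
  have h1 : ∀ r ∈ Set.Ioi (0 : ℝ), (∫⁻ θ in Set.Ioo (-Real.pi) Real.pi,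
      ENNReal.ofReal (r, θ).1 • {y : ℂ | β ≤ ‖y‖}.indicator (fun y => povmForm η ν y ψ)
        (Complex.polarCoord.symm (r, θ)))
      = (Set.Ici β).indicator (fun r => ∑' n, ENNReal.ofReal (2 * r * radialDensity η ν n r)
          * ‖ψ n‖ₑ ^ 2) r := by
    intro r hr
    have hr0 : 0 < r := hr
    simp only [hpolar, smul_eq_mul]
    have hn : ∀ θ : ℝ, ‖(r : ℂ) * Complex.exp (θ * Complex.I)‖ = r := fun θ => by
      rw [norm_mul, Complex.norm_exp_ofReal_mul_I, mul_one, Complex.norm_real,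
        Real.norm_of_nonneg hr0.le]
    by_cases hrb : β ≤ r
    · rw [Set.indicator_of_mem (show r ∈ Set.Ici β from hrb)]
      have : ∀ θ : ℝ, {y : ℂ | β ≤ ‖y‖}.indicator (fun y => povmForm η ν y ψ)
          ((r : ℂ) * Complex.exp (θ * Complex.I))
          = povmForm η ν ((r : ℂ) * Complex.exp (θ * Complex.I)) ψ := fun θ =>
        Set.indicator_of_mem (by simpa only [Set.mem_ofPred_eq, hn] using hrb) _
      simp only [this]
      rw [lintegral_const_mul' _ _ ENNReal.ofReal_ne_top, lintegral_circle_povmForm hη hη1 hν,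
        ← ENNReal.tsum_mul_left]
      refine tsum_congr fun n => ?_
      rw [← mul_assoc, ← ENNReal.ofReal_mul hr0.le]
      ring_nf
    · rw [Set.indicator_of_notMem (show r ∉ Set.Ici β from hrb)]
      have : ∀ θ : ℝ, {y : ℂ | β ≤ ‖y‖}.indicator (fun y => povmForm η ν y ψ)
          ((r : ℂ) * Complex.exp (θ * Complex.I)) = 0 := fun θ =>
        Set.indicator_of_notMem (by simpa only [Set.mem_ofPred_eq, hn] using hrb) _
      simp [this]
  have hrad : ∀ n, Measurable fun r : ℝ => ENNReal.ofReal (2 * r * radialDensity η ν n r)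
      * ‖ψ n‖ₑ ^ 2 := fun n => by
    have : Continuous (radialDensity η ν n) := by
      unfold radialDensity binomMean
      fun_prop
    fun_prop
  have hset : (Set.Ici β ∩ Set.Ioi 0 : Set ℝ) =ᵐ[volume] Set.Ioi β := by
    have h := (Ioi_ae_eq_Ici (μ := (volume : Measure ℝ)) (a := β)).symm.inter
      (ae_eq_refl (Set.Ioi (0 : ℝ)))
    rwa [Set.Ioi_inter_Ioi, sup_eq_left.2 hβ] at h
  rw [setLIntegral_congr_fun measurableSet_Ioi h1, lintegral_indicator measurableSet_Ici,
    Measure.restrict_restrict measurableSet_Ici, setLIntegral_congr hset,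
    lintegral_tsum fun n => (hrad n).aemeasurable]
  refine tsum_congr fun n => ?_
  rw [lintegral_mul_const' _ _ (by finiteness), lintegral_radialDensity hη hη1 hν n hβ]

/-! ### Product vectors and Born's rule for product operators -/

theorem summable_norm_prod_and_tsum {𝕜 : Type*} [RCLike 𝕜] {N : ℕ} (a : Fin N → ℕ → 𝕜)
    (h : ∀ i, Summable fun n => ‖a i n‖) :
    (Summable fun m : Fin N → ℕ => ‖∏ i, a i (m i)‖) ∧
      ∑' m : Fin N → ℕ, ∏ i, a i (m i) = ∏ i, ∑' n, a i n := by
  induction N with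
  | zero =>
    refine ⟨(hasSum_fintype _).summable, ?_⟩
    rw [tsum_fintype]
    simp
  | succ N ih =>
    obtain ⟨h1, h2⟩ := ih (fun i => a i.succ) fun i => h i.succ
    have e : ∀ p : ℕ × (Fin N → ℕ), ∏ i, a i (Fin.consEquiv (fun _ => ℕ) p i)
        = a 0 p.1 * ∏ i : Fin N, a i.succ (p.2 i) := fun p => by
      rw [Fin.prod_univ_succ]
      simp [Fin.consEquiv]
    obtain ⟨b, hb⟩ : ∃ b : (Fin N → ℕ) → 𝕜, ∀ m, ∏ i : Fin N, a i.succ (m i) = b m :=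
      ⟨_, fun _ => rfl⟩
    simp only [hb] at h1 h2 e
    rw [Fin.prod_univ_succ, ← h2, ← (Fin.consEquiv fun _ : Fin (N + 1) => ℕ).tsum_eq, tsum_congr e]
    refine ⟨?_, (tsum_mul_tsum_of_summable_norm (h 0) h1).symm⟩
    refine (Fin.consEquiv fun _ : Fin (N + 1) => ℕ).summable_iff.1 ?_
    exact ((h 0).mul_norm h1).congr fun p => (congrArg norm (e p)).symm

theorem memlp_prodVec {N : ℕ} (φ : Fin N → Mode) :
    Memℓp (fun m : Fin N → ℕ => ∏ i, φ i (m i)) 2 := by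
  refine (memℓp_gen_iff (p := 2) (by norm_num)).2 ?_
  have h : ∀ i, Summable fun n => ‖(‖φ i n‖ ^ 2 : ℝ)‖ := fun i => by
    have := (memℓp_gen_iff (p := 2) (by norm_num)).1 (lp.memℓp (φ i))
    simpa using this
  refine (summable_norm_prod_and_tsum (fun i n => (‖φ i n‖ ^ 2 : ℝ)) h).1.congr fun m => ?_
  simp [norm_prod, Finset.prod_pow]

/-- The product vector `φ 0 ⊗ ⋯ ⊗ φ (N-1)`. -/
def prodVec {N : ℕ} (φ : Fin N → Mode) : MultiMode N :=
  ⟨fun m => ∏ i, φ i (m i), memlp_prodVec φ⟩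

theorem prodVec_apply {N : ℕ} (φ : Fin N → Mode) (m : Fin N → ℕ) :
    prodVec φ m = ∏ i, φ i (m i) := rfl

theorem siteOp_apply {N : ℕ} (i : Fin N) (A : Mode →L[ℂ] Mode) (x : MultiMode N)
    (m : Fin N → ℕ) : siteOp i A x m = A (slice i m x) (m i) := rfl

theorem siteOp_prodVec {N : ℕ} (i : Fin N) (A : Mode →L[ℂ] Mode) (φ : Fin N → Mode) :
    siteOp i A (prodVec φ) = prodVec (Function.update φ i (A (φ i))) := by
  apply lp.ext
  funext m
  rw [siteOp_apply, prodVec_apply]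
  have h : slice i m (prodVec φ) = (∏ j ∈ Finset.univ.erase i, φ j (m j)) • φ i := by
    apply lp.ext
    funext n
    change ∏ j, φ j (Function.update m i n j) = (∏ j ∈ Finset.univ.erase i, φ j (m j)) * φ i n
    rw [← Finset.prod_erase_mul _ _ (Finset.mem_univ i), Function.update_self]
    congr 1
    refine Finset.prod_congr rfl fun j hj => ?_
    rw [Function.update_of_ne (Finset.ne_of_mem_erase hj)]
  rw [h, map_smul, ← Finset.prod_erase_mul _ _ (Finset.mem_univ i), Function.update_self]
  change (∏ j ∈ Finset.univ.erase i, φ j (m j)) * A (φ i) (m i) = _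
  congr 1
  refine Finset.prod_congr rfl fun j hj => ?_
  rw [Function.update_of_ne (Finset.ne_of_mem_erase hj)]

theorem list_prod_siteOp_prodVec {N : ℕ} (A : Fin N → (Mode →L[ℂ] Mode)) (φ : Fin N → Mode)
    (s : List (Fin N)) (hs : s.Nodup) :
    (s.map fun i => siteOp i (A i)).prod (prodVec φ)
      = prodVec fun i => if i ∈ s then A i (φ i) else φ i := by
  induction s with
  | nil => simp
  | cons j s ih =>
    obtain ⟨hj, hs'⟩ := List.nodup_cons.1 hs
    rw [List.map_cons, List.prod_cons, mul_apply_eq_comp, ih hs', siteOp_prodVec]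
    congr 1
    funext i
    by_cases h : i = j
    · subst h
      simp [hj]
    · simp [h]

theorem tensorOp_prodVec {N : ℕ} (A : Fin N → (Mode →L[ℂ] Mode)) (φ : Fin N → Mode) :
    tensorOp A (prodVec φ) = prodVec fun i => A i (φ i) := by
  rw [tensorOp, list_prod_siteOp_prodVec A φ _ (List.nodup_finRange N)]
  simp

theorem ket_apply {κ : Type} [DecidableEq κ] (m n : κ) :
    (ket m : L2 κ) n = if n = m then 1 else 0 := by
  by_cases h : n = m
  · subst h
    simp [ket]
  · simp [ket, h]

theorem ket_eq_prodVec {N : ℕ} (m : Fin N → ℕ) :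
    (ket m : MultiMode N) = prodVec fun i => ket (m i) := by
  apply lp.ext
  funext n
  rw [prodVec_apply, ket_apply]
  simp only [ket_apply]
  by_cases h : n = m
  · subst h
    simp
  · obtain ⟨i, hi⟩ := Function.ne_iff.1 h
    rw [if_neg h, Finset.prod_eq_zero (Finset.mem_univ i) (if_neg hi)]

/-- Number states are product vectors, so every diagonal entry is a product; absolute summability
turns the sum over multi-indices into a product of traces. -/
theorem tr_tensorPow_comp {N : ℕ} (ρ : DensityOperator) (E : Fin N → (Mode →L[ℂ] Mode))
    (h : ∀ i, Summable fun n => ‖inner ℂ (ket n) (ρ.op (E i (ket n)))‖) :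
    tr (ρ.tensorPow N ∘L tensorOp E) = ∏ i, tr (ρ.op ∘L E i) := by
  simp only [tr, ContinuousLinearMap.comp_apply, DensityOperator.tensorPow]
  rw [← (summable_norm_prod_and_tsum _ h).2]
  refine tsum_congr fun m => ?_
  rw [ket_inner, ket_eq_prodVec, tensorOp_prodVec, tensorOp_prodVec, prodVec_apply]
  simp only [ket_inner]

/-! ### Square roots of states, and the one-mode outcome density -/

/-- A self-adjoint root writes `⟨u|ρ|u⟩` as `‖S u‖²`, so traces against the state become sums of
nonnegative terms. -/
theorem exists_sqrt_of_isPositive {H : Type*} [NormedAddCommGroup H] [InnerProductSpace ℂ H]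
    [CompleteSpace H] {A : H →L[ℂ] H} (hA : A.IsPositive) :
    ∃ S : H →L[ℂ] H, (∀ x y, inner ℂ (S x) y = inner ℂ x (S y)) ∧ S ∘L S = A := by
  have h0 : 0 ≤ A := (ContinuousLinearMap.nonneg_iff_isPositive _).2 hA
  refine ⟨CFC.sqrt A, ?_, CFC.sqrt_mul_sqrt_self A h0⟩
  have h1 := (ContinuousLinearMap.nonneg_iff_isPositive _).1 (CFC.sqrt_nonneg A)
  exact fun x y => h1.isSymmetric x y

theorem tsum_enorm_inner_ket (v : Mode) : ∑' m, ‖inner ℂ (ket m) v‖ₑ ^ 2 = ‖v‖ₑ ^ 2 := by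
  rw [enorm_sq_eq_tsum]
  simp only [ket_inner]

theorem norm_displacedKet (γ : ℂ) (k : ℕ) : ‖displacedKet γ k‖ = 1 := by
  have h := lp.norm_rpow_eq_tsum (p := 2) (by norm_num) (displacedKet γ k)
  simp only [ENNReal.toReal_ofNat, Real.rpow_two, displacedKet_apply] at h
  rw [(hasSum_norm_sq_dispCoeff_left γ k).tsum_eq] at h
  nlinarith [norm_nonneg (displacedKet γ k)]

theorem summable_povmCoeff {η ν : ℝ} (hη : 0 < η) (hη1 : η ≤ 1) (hν : 0 ≤ ν) :
    Summable (povmCoeff η ν) := by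
  have h := sub_nonneg.2 (transmissivity_le_one hη1 hν)
  have h2 := transmissivity_pos hη hν
  refine ((summable_geometric_of_lt_one h (by linarith)).mul_left
    (Real.pi * (1 + ν))⁻¹).congr fun k => ?_
  rw [povmCoeff_eq hη hν]

theorem hasSum_nonidealPOVM {η ν : ℝ} (hη : 0 < η) (hη1 : η ≤ 1) (hν : 0 ≤ ν) (y : ℂ) :
    HasSum (fun k => (povmCoeff η ν k : ℂ) • InnerProductSpace.rankOne ℂ
      (displacedKet (y / (Real.sqrt η : ℂ)) k) (displacedKet (y / (Real.sqrt η : ℂ)) k))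
      (nonidealPOVM η ν y) := by
  have hs : Summable fun k => (((((1 - η + ν) / η) ^ k / (1 + (1 - η + ν) / η) ^ (k + 1) : ℝ)) : ℂ) •
      InnerProductSpace.rankOne ℂ
      (displacedKet (y / (Real.sqrt η : ℂ)) k) (displacedKet (y / (Real.sqrt η : ℂ)) k) := by
    refine Summable.of_norm_bounded ((summable_povmCoeff hη hη1 hν).mul_left (η * Real.pi))
      fun k => ?_
    have hn : 0 ≤ (1 - η + ν) / η := by
      have := sub_nonneg.2 hη1
      positivity
    rw [norm_smul, InnerProductSpace.norm_rankOne, norm_displacedKet, mul_one, mul_one,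
      Complex.norm_real, Real.norm_of_nonneg (by positivity), povmCoeff]
    have := Real.pi_pos
    field_simp
    exact le_rfl
  refine (hs.hasSum.const_smul (((1 / (η * Real.pi) : ℝ)) : ℂ)).of_eq (fun k => ?_) rfl
  rw [smul_smul, ← Complex.ofReal_mul]
  rfl

theorem hasSum_nonidealPOVM_apply {η ν : ℝ} (hη : 0 < η) (hη1 : η ≤ 1) (hν : 0 ≤ ν) (y : ℂ)
    (A : Mode →L[ℂ] Mode) (φ ψ : Mode) :
    HasSum (fun k => (povmCoeff η ν k : ℂ) *
      (inner ℂ φ (A (displacedKet (y / (Real.sqrt η : ℂ)) k)) *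
        inner ℂ (displacedKet (y / (Real.sqrt η : ℂ)) k) ψ))
      (inner ℂ φ (A (nonidealPOVM η ν y ψ))) := by
  have h := (hasSum_nonidealPOVM hη hη1 hν y).mapL
    ((innerSL ℂ φ).comp (A.comp (ContinuousLinearMap.apply ℂ Mode ψ)))
  refine h.of_eq (fun k => ?_) (by simp)
  simp only [map_smul, ContinuousLinearMap.comp_apply, ContinuousLinearMap.apply_apply,
    InnerProductSpace.rankOne_apply, innerSL_apply_apply, smul_eq_mul]
  ring

theorem hasSum_inner_nonidealPOVM {η ν : ℝ} (hη : 0 < η) (hη1 : η ≤ 1) (hν : 0 ≤ ν) (y : ℂ)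
    (ψ : Mode) :
    HasSum (fun k => povmCoeff η ν k * ‖inner ℂ (displacedKet (y / (Real.sqrt η : ℂ)) k) ψ‖ ^ 2)
      (inner ℂ ψ (nonidealPOVM η ν y ψ)).re := by
  have h := Complex.hasSum_re (hasSum_nonidealPOVM_apply hη hη1 hν y
    (ContinuousLinearMap.id ℂ Mode) ψ ψ)
  refine h.of_eq (fun k => ?_) rfl
  rw [ContinuousLinearMap.id_apply,
    ← inner_conj_symm ψ (displacedKet (y / (Real.sqrt η : ℂ)) k), Complex.conj_mul',
    ← Complex.ofReal_pow, ← Complex.ofReal_mul, Complex.ofReal_re]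

theorem ofReal_inner_nonidealPOVM {η ν : ℝ} (hη : 0 < η) (hη1 : η ≤ 1) (hν : 0 ≤ ν) (y : ℂ)
    (ψ : Mode) :
    ENNReal.ofReal (inner ℂ ψ (nonidealPOVM η ν y ψ)).re = povmForm η ν y ψ := by
  have hc := povmCoeff_nonneg hη hη1 hν
  have h := hasSum_inner_nonidealPOVM hη hη1 hν y ψ
  rw [← h.tsum_eq, ENNReal.ofReal_tsum_of_nonneg
    (fun k => mul_nonneg (hc k) (by positivity)) h.summable]
  refine tsum_congr fun k => ?_
  rw [ENNReal.ofReal_mul (hc k), ENNReal.ofReal_pow (norm_nonneg _), ofReal_norm]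

theorem tsum_testWeight_mul_lt_top {η ν : ℝ} (hη : 0 < η) (hη1 : η ≤ 1) (hν : 0 ≤ ν) {β : ℝ}
    (hβ : 0 < β) (ψ : Mode) :
    ∑' n, ENNReal.ofReal (testWeight η ν n β) * ‖ψ n‖ₑ ^ 2 < ⊤ := by
  refine lt_of_le_of_lt (b := ‖ψ‖ₑ ^ 2) ?_ (by finiteness)
  rw [enorm_sq_eq_tsum]
  refine ENNReal.tsum_le_tsum fun n => ?_
  refine mul_le_of_le_one_left' ?_
  rw [ENNReal.ofReal_le_one]
  exact (testWeight_lt_one hη hη1 hν n hβ).le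

theorem ofReal_testForm_nonidealPOVM {η ν : ℝ} (hη : 0 < η) (hη1 : η ≤ 1) (hν : 0 ≤ ν) {β : ℝ}
    (hβ : 0 < β) (ψ : Mode) :
    ENNReal.ofReal (testForm (nonidealPOVM η ν) β ψ)
      = ∑' n, ENNReal.ofReal (testWeight η ν n β) * ‖ψ n‖ₑ ^ 2 := by
  have hnn : ∀ y, 0 ≤ (inner ℂ ψ (nonidealPOVM η ν y ψ)).re := fun y =>
    (hasSum_inner_nonidealPOVM hη hη1 hν y ψ).nonneg fun k =>
      mul_nonneg (povmCoeff_nonneg hη hη1 hν k) (by positivity)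
  have hval : ∀ y, (inner ℂ ψ (nonidealPOVM η ν y ψ)).re = (povmForm η ν y ψ).toReal := fun y => by
    rw [← ofReal_inner_nonidealPOVM hη hη1 hν, ENNReal.toReal_ofReal (hnn y)]
  have hmeas : Measurable fun y => (inner ℂ ψ (nonidealPOVM η ν y ψ)).re := by
    simp only [hval]
    exact (measurable_povmForm η ν ψ).ennreal_toReal
  have hfin := tsum_testWeight_mul_lt_top hη hη1 hν hβ ψ
  rw [testForm, integral_eq_lintegral_of_nonneg_ae (Filter.Eventually.of_forall hnn)
    hmeas.aestronglyMeasurable]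
  simp only [ofReal_inner_nonidealPOVM hη hη1 hν]
  rw [lintegral_povmForm hη hη1 hν hβ.le, ENNReal.ofReal_toReal hfin.ne]

/-- The outcome density of a single round, for a state with square root `S`. -/
def outcomeDensity (η ν : ℝ) (S : Mode →L[ℂ] Mode) (y : ℂ) : ENNReal :=
  ∑' m, povmForm η ν y (S (ket m))

theorem measurable_outcomeDensity (η ν : ℝ) (S : Mode →L[ℂ] Mode) :
    Measurable (outcomeDensity η ν S) :=
  Measurable.tsum fun m => measurable_povmForm η ν (S (ket m))

theorem outcomeDensity_eq (η ν : ℝ) (S : Mode →L[ℂ] Mode)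
    (hS : ∀ x y, inner ℂ (S x) y = inner ℂ x (S y)) (y : ℂ) :
    outcomeDensity η ν S y = ∑' k, ENNReal.ofReal (povmCoeff η ν k) *
      ‖S (displacedKet (y / (Real.sqrt η : ℂ)) k)‖ₑ ^ 2 := by
  simp only [outcomeDensity, povmForm]
  rw [ENNReal.tsum_comm]
  refine tsum_congr fun k => ?_
  rw [ENNReal.tsum_mul_left, ← tsum_enorm_inner_ket]
  congr 1
  refine tsum_congr fun m => ?_
  rw [← hS, ← ofReal_norm, ← ofReal_norm, norm_inner_symm]

theorem norm_sq_eq_tsum (v : Mode) : HasSum (fun m => ‖v m‖ ^ 2) (‖v‖ ^ 2) := by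
  have hs := (memℓp_gen_iff (p := 2) (by norm_num)).1 (lp.memℓp v)
  have h := lp.norm_rpow_eq_tsum (p := 2) (by norm_num) v
  simp only [ENNReal.toReal_ofNat, Real.rpow_two] at h hs
  rw [h]
  exact hs.hasSum

/-- The trace is a double series over thermal index `k` and basis index `m`. Cauchy's inequality
`2xy ≤ x² + y²` and the summable thermal weights make it absolutely convergent. Summing over `m`
first gives `‖S u_k‖²`, over `k` first the diagonal of `ρ E_y`. -/
theorem tr_comp_nonidealPOVM {η ν : ℝ} (hη : 0 < η) (hη1 : η ≤ 1) (hν : 0 ≤ ν) (y : ℂ)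
    (ρ : DensityOperator) (S : Mode →L[ℂ] Mode)
    (hS : ∀ x y, inner ℂ (S x) y = inner ℂ x (S y)) (hSS : S ∘L S = ρ.op) :
    (Summable fun n => ‖inner ℂ (ket n) (ρ.op (nonidealPOVM η ν y (ket n)))‖) ∧
      ∃ t : ℝ, 0 ≤ t ∧ tr (ρ.op ∘L nonidealPOVM η ν y) = t ∧
        ENNReal.ofReal t = outcomeDensity η ν S y := by
  have hc := povmCoeff_nonneg hη hη1 hν
  set u : ℕ → Mode := fun k => displacedKet (y / (Real.sqrt η : ℂ)) k with hu
  have hu1 : ∀ k, ‖u k‖ = 1 := fun k => norm_displacedKet _ k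
  set F : ℕ × ℕ → ℂ := fun p => (povmCoeff η ν p.1 : ℂ) *
    (inner ℂ (ket p.2) (ρ.op (u p.1)) * inner ℂ (u p.1) (ket p.2)) with hF
  have hnF : ∀ p, ‖F p‖ ≤ povmCoeff η ν p.1 * ((‖ρ.op (u p.1) p.2‖ ^ 2 + ‖u p.1 p.2‖ ^ 2) / 2) := by
    intro p
    rw [hF]
    simp only [norm_mul]
    rw [norm_inner_symm (u p.1), ket_inner, ket_inner, Complex.norm_real,
      Real.norm_of_nonneg (hc _)]
    refine mul_le_mul_of_nonneg_left ?_ (hc _)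
    nlinarith [sq_nonneg (‖ρ.op (u p.1) p.2‖ - ‖u p.1 p.2‖)]
  have hrow : ∀ k, HasSum (fun m => povmCoeff η ν k * ((‖ρ.op (u k) m‖ ^ 2 + ‖u k m‖ ^ 2) / 2))
      (povmCoeff η ν k * ((‖ρ.op (u k)‖ ^ 2 + ‖u k‖ ^ 2) / 2)) := fun k =>
    (((norm_sq_eq_tsum (ρ.op (u k))).add (norm_sq_eq_tsum (u k))).div_const 2).mul_left _
  have hbound : Summable fun p : ℕ × ℕ =>
      povmCoeff η ν p.1 * ((‖ρ.op (u p.1) p.2‖ ^ 2 + ‖u p.1 p.2‖ ^ 2) / 2) := by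
    rw [summable_prod_of_nonneg fun p => mul_nonneg (hc _) (by positivity)]
    refine ⟨fun k => (hrow k).summable, ?_⟩
    simp only [fun k => (hrow k).tsum_eq]
    refine Summable.of_nonneg_of_le (fun k => mul_nonneg (hc _) (by positivity)) (fun k => ?_)
      ((summable_povmCoeff hη hη1 hν).mul_right ((‖ρ.op‖ ^ 2 + 1) / 2))
    have h1 : ‖ρ.op (u k)‖ ≤ ‖ρ.op‖ := by
      simpa [hu1 k] using ρ.op.le_opNorm (u k)
    rw [hu1 k]
    have := hc k
    gcongr
    norm_num
  have hFs : Summable F := Summable.of_norm_bounded hbound hnF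
  have hinner : ∀ m, HasSum (fun k => F (k, m))
      (inner ℂ (ket m) (ρ.op (nonidealPOVM η ν y (ket m)))) := fun m =>
    hasSum_nonidealPOVM_apply hη hη1 hν y ρ.op (ket m) (ket m)
  have houter : ∀ k, HasSum (fun m => F (k, m))
      ((povmCoeff η ν k * ‖S (u k)‖ ^ 2 : ℝ) : ℂ) := by
    intro k
    have h := lp.hasSum_inner (𝕜 := ℂ) (u k) (ρ.op (u k))
    refine (h.mul_left (povmCoeff η ν k : ℂ)).of_eq (fun m => ?_) ?_
    · rw [hF]
      simp only
      rw [← inner_conj_symm (u k) (ket m), ket_inner, ket_inner, RCLike.inner_apply]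
    · rw [← hSS, ContinuousLinearMap.comp_apply, ← hS, inner_self_eq_norm_sq_to_K]
      push_cast
      rfl
  have hswap : HasSum F (∑' p, F p) := hFs.hasSum
  have h1 : HasSum (fun k => ((povmCoeff η ν k * ‖S (u k)‖ ^ 2 : ℝ) : ℂ)) (∑' p, F p) :=
    hswap.prod_fiberwise houter
  have h2 : HasSum (fun m => inner ℂ (ket m) (ρ.op (nonidealPOVM η ν y (ket m)))) (∑' p, F p) :=
    ((Equiv.prodComm ℕ ℕ).hasSum_iff.2 hswap).prod_fiberwise hinner
  refine ⟨h2.summable.norm, ∑' k, povmCoeff η ν k * ‖S (u k)‖ ^ 2,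
    tsum_nonneg fun k => mul_nonneg (hc k) (by positivity), ?_, ?_⟩
  · rw [tr]
    simp only [ContinuousLinearMap.comp_apply]
    rw [h2.tsum_eq, ← h1.tsum_eq, Complex.ofReal_tsum]
  · have h3 : Summable fun k => povmCoeff η ν k * ‖S (u k)‖ ^ 2 :=
      Complex.summable_ofReal.1 h1.summable
    rw [outcomeDensity_eq η ν S hS, ENNReal.ofReal_tsum_of_nonneg
      (fun k => mul_nonneg (hc k) (by positivity)) h3]
    refine tsum_congr fun k => ?_
    rw [ENNReal.ofReal_mul (hc k), ENNReal.ofReal_pow (norm_nonneg _), ofReal_norm]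

theorem ofReal_tr_tensorPow {η ν : ℝ} (hη : 0 < η) (hη1 : η ≤ 1) (hν : 0 ≤ ν)
    (ρ : DensityOperator) (S : Mode →L[ℂ] Mode)
    (hS : ∀ x y, inner ℂ (S x) y = inner ℂ x (S y)) (hSS : S ∘L S = ρ.op) {N : ℕ}
    (y : Fin N → ℂ) :
    ENNReal.ofReal (tr (ρ.tensorPow N ∘L tensorOp fun i => nonidealPOVM η ν (y i))).re
      = ∏ i, outcomeDensity η ν S (y i) := by
  have h := fun i => tr_comp_nonidealPOVM hη hη1 hν (y i) ρ S hS hSS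
  choose h1 t ht0 ht1 ht2 using h
  rw [tr_tensorPow_comp ρ _ h1]
  simp only [ht1, ← ht2]
  rw [← Complex.ofReal_prod, Complex.ofReal_re, ENNReal.ofReal_prod_of_nonneg fun i _ => ht0 i]

theorem inner_ket_eq_norm_sq_sqrt (ρ : DensityOperator) (S : Mode →L[ℂ] Mode)
    (hS : ∀ x y, inner ℂ (S x) y = inner ℂ x (S y)) (hSS : S ∘L S = ρ.op) (n : ℕ) :
    inner ℂ (ket n) (ρ.op (ket n)) = ((‖S (ket n)‖ ^ 2 : ℝ) : ℂ) := by
  rw [← hSS, ContinuousLinearMap.comp_apply, ← hS, inner_self_eq_norm_sq_to_K]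
  push_cast
  rfl

theorem hasSum_norm_sq_sqrt_ket (ρ : DensityOperator) (S : Mode →L[ℂ] Mode)
    (hS : ∀ x y, inner ℂ (S x) y = inner ℂ x (S y)) (hSS : S ∘L S = ρ.op) :
    HasSum (fun n => ‖S (ket n)‖ ^ 2) 1 := by
  have h := ρ.trace_one
  simp only [inner_ket_eq_norm_sq_sqrt ρ S hS hSS] at h
  rw [← Complex.ofReal_one] at h
  exact Complex.hasSum_ofReal.1 h

/-- This is `Tr[ρ V₁]` with `V₁` diagonal; Parseval and the symmetry of `S` convert the sum over `m`
into `⟨n|ρ|n⟩`. -/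
theorem lintegral_outcomeDensity {η ν : ℝ} (hη : 0 < η) (hη1 : η ≤ 1) (hν : 0 ≤ ν) {β : ℝ}
    (hβ : 0 ≤ β) (S : Mode →L[ℂ] Mode) (hS : ∀ x y, inner ℂ (S x) y = inner ℂ x (S y)) :
    ∫⁻ y in {y : ℂ | β ≤ ‖y‖}, outcomeDensity η ν S y
      = ∑' n, ENNReal.ofReal (testWeight η ν n β) * ‖S (ket n)‖ₑ ^ 2 := by
  simp only [outcomeDensity]
  rw [lintegral_tsum fun m => (measurable_povmForm η ν (S (ket m))).aemeasurable]
  simp only [lintegral_povmForm hη hη1 hν hβ]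
  rw [ENNReal.tsum_comm]
  refine tsum_congr fun n => ?_
  rw [ENNReal.tsum_mul_left, ← tsum_enorm_inner_ket]
  congr 1
  refine tsum_congr fun m => ?_
  rw [← ket_inner n (S (ket m)), ← hS, ← ofReal_norm, ← ofReal_norm, norm_inner_symm]

/-! ### Number-state projectors -/

theorem starProjection_inner_ket {K : Submodule ℂ Mode} [K.HasOrthogonalProjection] {p : ℕ → Prop}
    [DecidablePred p] (h1 : ∀ n, p n → (ket n : Mode) ∈ K) (h2 : ∀ n, ¬ p n → (ket n : Mode) ∈ Kᗮ)
    (n : ℕ) (v : Mode) : inner ℂ (ket n) (K.starProjection v) = if p n then v n else 0 := by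
  rw [← Submodule.inner_starProjection_left_eq_right]
  by_cases h : p n
  · rw [Submodule.starProjection_eq_self_iff.2 (h1 n h), if_pos h, ket_inner]
  · rw [(Submodule.starProjection_apply_eq_zero_iff K).2 (h2 n h), if_neg h, inner_zero_left]

theorem inner_ket_ket {m n : ℕ} (h : m ≠ n) : inner ℂ (ket m : Mode) (ket n) = 0 := by
  rw [ket_inner, ket_apply, if_neg h]

theorem inner_ket_tailProj (nc n : ℕ) (v : Mode) :
    inner ℂ (ket n) (tailProj nc v) = if nc ≤ n then v n else 0 := by
  refine starProjection_inner_ket (p := fun n => nc ≤ n) (fun m hm => ?_) (fun m hm => ?_) n v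
  · exact Submodule.le_topologicalClosure _ (Submodule.subset_span ⟨m, hm, rfl⟩)
  · rw [Submodule.orthogonal_closure, Submodule.mem_orthogonal]
    intro u hu
    induction hu using Submodule.span_induction with
    | mem x hx =>
      obtain ⟨j, hj, rfl⟩ := hx
      exact inner_ket_ket (by omega)
    | zero => simp
    | add x y _ _ hx hy => rw [inner_add_left, hx, hy, add_zero]
    | smul c x _ hx => rw [inner_smul_left, hx, mul_zero]

theorem inner_ket_cutoffCompl (nc n : ℕ) (v : Mode) :
    inner ℂ (ket n) (cutoffCompl nc v) = if nc < n then v n else 0 := by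
  refine starProjection_inner_ket (p := fun n => nc < n) (fun m hm => ?_) (fun m hm => ?_) n v
  · rw [Submodule.mem_orthogonal]
    intro u hu
    induction hu using Submodule.span_induction with
    | mem x hx =>
      obtain ⟨j, hj, rfl⟩ := hx
      exact inner_ket_ket (by omega)
    | zero => simp
    | add x y _ _ hx hy => rw [inner_add_left, hx, hy, add_zero]
    | smul c x _ hx => rw [inner_smul_left, hx, mul_zero]
  · exact Submodule.le_orthogonal_orthogonal _ (Submodule.subset_span ⟨m, by omega, rfl⟩)

theorem hasSum_inner_tailProj (nc : ℕ) (ψ : Mode) :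
    HasSum (fun n => if nc ≤ n then ‖ψ n‖ ^ 2 else 0) (inner ℂ ψ (tailProj nc ψ)).re := by
  refine (Complex.hasSum_re (lp.hasSum_inner (𝕜 := ℂ) ψ (tailProj nc ψ))).of_eq (fun n => ?_) rfl
  rw [← ket_inner n (tailProj nc ψ), inner_ket_tailProj, RCLike.inner_apply]
  by_cases h : nc ≤ n
  · rw [if_pos h, if_pos h, Complex.mul_conj', ← Complex.ofReal_pow, Complex.ofReal_re]
  · simp [h]

theorem tailProj_le {η ν : ℝ} (hη : 0 < η) (hη1 : η ≤ 1) (hν : 0 ≤ ν) {β : ℝ}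
    (hβ : 0 < β) (nc : ℕ) (ψ : Mode) :
    (inner ℂ ψ (tailProj nc ψ)).re ≤ rNonideal η ν nc β * testForm (nonidealPOVM η ν) β ψ := by
  have hw := testWeight_pos hη hη1 hν nc β
  rw [rNonideal_eq hν, ← div_eq_inv_mul, le_div_iff₀' hw]
  have hs := hasSum_inner_tailProj nc ψ
  have hnn : ∀ n, 0 ≤ if nc ≤ n then ‖ψ n‖ ^ 2 else 0 := fun n => by split_ifs <;> positivity
  have hform : 0 ≤ testForm (nonidealPOVM η ν) β ψ :=
    integral_nonneg fun y => (hasSum_inner_nonidealPOVM hη hη1 hν y ψ).nonneg fun k =>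
      mul_nonneg (povmCoeff_nonneg hη hη1 hν k) (by positivity)
  rw [← ENNReal.ofReal_le_ofReal_iff hform, ofReal_testForm_nonidealPOVM hη hη1 hν hβ,
    ENNReal.ofReal_mul hw.le, ← hs.tsum_eq, ENNReal.ofReal_tsum_of_nonneg hnn hs.summable,
    ← ENNReal.tsum_mul_left]
  refine ENNReal.tsum_le_tsum fun n => ?_
  by_cases h : nc ≤ n
  · rw [if_pos h, ENNReal.ofReal_pow (norm_nonneg _), ofReal_norm]
    gcongr
    exact testWeight_mono hη hη1 hν β h
  · simp [h]

/-- The weight of a state, with square root `S`, on the number states with at least `nc` photons. -/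
def tailWeight (S : Mode →L[ℂ] Mode) (nc : ℕ) : ℝ :=
  ∑' n, if nc ≤ n then ‖S (ket n)‖ ^ 2 else 0

theorem summable_ite_norm_sq_sqrt {ρ : DensityOperator} {S : Mode →L[ℂ] Mode}
    (hS : ∀ x y, inner ℂ (S x) y = inner ℂ x (S y)) (hSS : S ∘L S = ρ.op)
    (p : ℕ → Prop) [DecidablePred p] : Summable fun n => if p n then ‖S (ket n)‖ ^ 2 else 0 := by
  refine Summable.of_nonneg_of_le (fun n => ?_) (fun n => ?_)
    (hasSum_norm_sq_sqrt_ket ρ S hS hSS).summable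
  · split_ifs <;> positivity
  · split_ifs
    · exact le_rfl
    · positivity

/-- `Π^⊥` starts at `nc + 1` and `W₁` at `nc`, so the first hypothesis is the stronger one. -/
theorem le_tailWeight {ρ : DensityOperator} {S : Mode →L[ℂ] Mode}
    (hS : ∀ x y, inner ℂ (S x) y = inner ℂ x (S y)) (hSS : S ∘L S = ρ.op) {w : ℝ} {nc : ℕ}
    (h : w ≤ (tr (cutoffCompl nc ∘L ρ.op)).re ∨ w ≤ (tr (tailProj nc ∘L ρ.op)).re) :
    w ≤ tailWeight S nc := by
  have hdiag : ∀ n, ρ.op (ket n) n = ((‖S (ket n)‖ ^ 2 : ℝ) : ℂ) := fun n => by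
    rw [← inner_ket_eq_norm_sq_sqrt ρ S hS hSS, ket_inner]
  have hsum := fun (p : ℕ → Prop) (_ : DecidablePred p) => summable_ite_norm_sq_sqrt hS hSS p
  rcases h with h | h
  · refine h.trans ?_
    have e : tr (cutoffCompl nc ∘L ρ.op)
        = ((∑' n, if nc < n then ‖S (ket n)‖ ^ 2 else 0 : ℝ) : ℂ) := by
      rw [tr, Complex.ofReal_tsum]
      refine tsum_congr fun n => ?_
      rw [ContinuousLinearMap.comp_apply, inner_ket_cutoffCompl, hdiag]
      split_ifs <;> simp
    rw [e, Complex.ofReal_re]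
    refine Summable.tsum_le_tsum (fun n => ?_) (hsum _ _) (hsum _ _)
    by_cases hn : nc < n
    · rw [if_pos hn, if_pos hn.le]
    · rw [if_neg hn]
      split_ifs <;> positivity
  · refine h.trans (le_of_eq ?_)
    have e : tr (tailProj nc ∘L ρ.op) = ((tailWeight S nc : ℝ) : ℂ) := by
      rw [tr, tailWeight, Complex.ofReal_tsum]
      refine tsum_congr fun n => ?_
      rw [ContinuousLinearMap.comp_apply, inner_ket_tailProj, hdiag]
      split_ifs <;> simp
    rw [e, Complex.ofReal_re]

theorem le_lintegral_outcomeDensity {η ν : ℝ} (hη : 0 < η) (hη1 : η ≤ 1) (hν : 0 ≤ ν) {β : ℝ}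
    (hβ : 0 ≤ β) {ρ : DensityOperator} {S : Mode →L[ℂ] Mode}
    (hS : ∀ x y, inner ℂ (S x) y = inner ℂ x (S y)) (hSS : S ∘L S = ρ.op) (nc : ℕ) :
    ENNReal.ofReal (testWeight η ν nc β * tailWeight S nc)
      ≤ ∫⁻ y in {y : ℂ | β ≤ ‖y‖}, outcomeDensity η ν S y := by
  have hnn : ∀ n, 0 ≤ if nc ≤ n then ‖S (ket n)‖ ^ 2 else 0 := fun n => by
    split_ifs <;> positivity
  rw [lintegral_outcomeDensity hη hη1 hν hβ S hS, tailWeight,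
    ENNReal.ofReal_mul (testWeight_pos hη hη1 hν nc β).le,
    ENNReal.ofReal_tsum_of_nonneg hnn (summable_ite_norm_sq_sqrt hS hSS _),
    ← ENNReal.tsum_mul_left]
  refine ENNReal.tsum_le_tsum fun n => ?_
  by_cases h : nc ≤ n
  · rw [if_pos h, ENNReal.ofReal_pow (norm_nonneg _), ofReal_norm]
    gcongr
    exact testWeight_mono hη hη1 hν β h
  · simp [h]

theorem lintegral_outcomeDensity_univ {η ν : ℝ} (hη : 0 < η) (hη1 : η ≤ 1) (hν : 0 ≤ ν)
    {ρ : DensityOperator} {S : Mode →L[ℂ] Mode}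
    (hS : ∀ x y, inner ℂ (S x) y = inner ℂ x (S y)) (hSS : S ∘L S = ρ.op) :
    ∫⁻ y, outcomeDensity η ν S y = 1 := by
  have h := lintegral_outcomeDensity hη hη1 hν le_rfl S hS
  have hu : {y : ℂ | 0 ≤ ‖y‖} = Set.univ := Set.eq_univ_of_forall fun y => norm_nonneg y
  have hs := hasSum_norm_sq_sqrt_ket ρ S hS hSS
  rw [hu, Measure.restrict_univ] at h
  rw [h]
  simp only [testWeight_zero, ENNReal.ofReal_one, one_mul]
  rw [← ENNReal.ofReal_one, ← hs.tsum_eq, ENNReal.ofReal_tsum_of_nonneg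
    (fun n => by positivity) hs.summable]
  refine tsum_congr fun n => ?_
  rw [ENNReal.ofReal_pow (norm_nonneg _), ofReal_norm]

/-! ### The energy test -/

/-- Clipping shrinks both coordinates; if it changes one, that coordinate becomes `±M`, whose
modulus is already at least `β`. -/
theorem le_norm_clip_iff {β M : ℝ} (hβ : 0 < β) (hM : β ≤ M) (y : ℂ) :
    β ≤ ‖clip M y‖ ↔ β ≤ ‖y‖ := by
  have habs : ∀ t : ℝ, |max (-M) (min M t)| = min M |t| := fun t => by
    rcases abs_cases t with ⟨h1, h2⟩ | ⟨h1, h2⟩ <;> rw [h1] <;>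
      rcases le_total M t with h3 | h3 <;> rcases le_total M (-t) with h4 | h4 <;>
      rcases abs_cases (max (-M) (min M t)) with ⟨h5, h6⟩ | ⟨h5, h6⟩ <;> rw [h5] <;>
      simp only [max_def, min_def] at * <;> split_ifs at * <;> linarith
  constructor
  · intro h
    refine h.trans ?_
    rw [← abs_norm (clip M y), ← abs_norm y, ← sq_le_sq, Complex.sq_norm, Complex.sq_norm,
      Complex.normSq_apply, Complex.normSq_apply, ← sq, ← sq, ← sq, ← sq]
    refine add_le_add (sq_le_sq.2 ?_) (sq_le_sq.2 ?_) <;>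
      exact (habs _).le.trans (min_le_right _ _)
  · intro h
    by_cases h1 : M ≤ |y.re|
    · have h2 : |(clip M y).re| = M := (habs y.re).trans (min_eq_left h1)
      have := Complex.abs_re_le_norm (clip M y)
      linarith
    by_cases h2 : M ≤ |y.im|
    · have h3 : |(clip M y).im| = M := (habs y.im).trans (min_eq_left h2)
      have := Complex.abs_im_le_norm (clip M y)
      linarith
    · have h3 := abs_lt.1 (not_le.1 h1)
      have h4 := abs_lt.1 (not_le.1 h2)
      have : clip M y = y := by
        apply Complex.ext
        · exact (max_eq_right (le_min (by linarith) h3.1.le)).trans (min_eq_right h3.2.le)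
        · exact (max_eq_right (le_min (by linarith) h4.1.le)).trans (min_eq_right h4.2.le)
      rwa [this]

theorem lintegral_fin_prod_eq_prod {E : Type*} [MeasureSpace E]
    [SigmaFinite (volume : Measure E)] {N : ℕ} (f : Fin N → E → ENNReal)
    (hf : ∀ i, Measurable (f i)) :
    ∫⁻ x : Fin N → E, ∏ i, f i (x i) = ∏ i, ∫⁻ x, f i x := by
  induction N with
  | zero => simp [volume_pi]
  | succ N ih =>
    rw [Fin.prod_univ_succ, ← ih (fun i => f i.succ) fun i => hf i.succ,
      ← lintegral_prod_mul (hf 0).aemeasurable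
        (Finset.measurable_fun_prod _ fun i _ => (hf i.succ).comp (measurable_pi_apply i)).aemeasurable,
      ← (volume_preserving_piFinSuccAbove (fun _ : Fin (N + 1) => E) 0).symm.lintegral_comp_emb
        (MeasurableEquiv.measurableEmbedding _)]
    refine lintegral_congr fun p => ?_
    rw [Fin.prod_univ_succ]
    simp [MeasurableEquiv.piFinSuccAbove_symm_apply, Fin.insertNthEquiv]

theorem measurableSet_passes {N : ℕ} (T : Finset (Fin N)) (l : ℕ) {β M : ℝ} (hβ : 0 < β)
    (hM : β ≤ M) : MeasurableSet (passes T l β M) := by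
  have e : passes T l β M = {y : Fin N → ℂ | ∑ j ∈ T, (if β ≤ ‖y j‖ then 1 else 0) ≤ l} := by
    ext y
    simp only [passes, Set.mem_ofPred_eq, Finset.card_filter, le_norm_clip_iff hβ hM]
  rw [e]
  refine measurableSet_le (Finset.measurable_fun_sum _ fun j _ => ?_) measurable_const
  exact Measurable.ite (measurableSet_le measurable_const (by fun_prop)) measurable_const
    measurable_const

/-- Exponential Markov inequality: since `s ≤ 1`, passing implies `s ^ l ≤ s ^ (number of
exceedances)`. The product structure separates the rounds, and untested ones integrate to `1`. -/
theorem pow_mul_lintegral_passes_le {N k l : ℕ} {T : Finset (Fin N)} (hT : T.card = k)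
    {f : ℂ → ENNReal} (hf : Measurable f) (hf1 : ∫⁻ y, f y = 1) {β M : ℝ} (hβ : 0 < β)
    (hM : β ≤ M) {s : ENNReal} (hs : s ≤ 1) :
    s ^ l * ∫⁻ y in passes T l β M, ∏ i, f (y i)
      ≤ (s * (∫⁻ y in {y : ℂ | β ≤ ‖y‖}, f y) + ∫⁻ y in {y : ℂ | β ≤ ‖y‖}ᶜ, f y) ^ k := by
  classical
  have hB : MeasurableSet {y : ℂ | β ≤ ‖y‖} := measurableSet_le measurable_const measurable_norm
  set g : ℂ → ENNReal := fun y => if β ≤ ‖y‖ then s else 1 with hg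
  have hgm : Measurable g := Measurable.ite hB measurable_const measurable_const
  set F : Fin N → ℂ → ENNReal := fun i y => if i ∈ T then f y * g y else f y with hF
  have hFm : ∀ i, Measurable (F i) := fun i => by
    by_cases h : i ∈ T
    · simp only [hF, h, if_true]
      exact hf.mul hgm
    · simp only [hF, h, if_false]
      exact hf
  have hFint : ∀ i, ∫⁻ y, F i y
      = if i ∈ T then s * (∫⁻ y in {y : ℂ | β ≤ ‖y‖}, f y) + ∫⁻ y in {y : ℂ | β ≤ ‖y‖}ᶜ, f y
        else 1 := by
    intro i
    by_cases h : i ∈ T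
    · simp only [hF, h, if_true]
      rw [← lintegral_add_compl _ hB, ← lintegral_const_mul _ hf]
      congr 1
      · refine setLIntegral_congr_fun hB fun y hy => ?_
        simp only [hg]
        rw [if_pos (show β ≤ ‖y‖ from hy), mul_comm]
      · refine setLIntegral_congr_fun hB.compl fun y hy => ?_
        simp only [hg]
        rw [if_neg (show ¬ β ≤ ‖y‖ from hy), mul_one]
    · simp only [hF, h, if_false]
      exact hf1
  have hpt : ∀ y ∈ passes T l β M, s ^ l * ∏ i, f (y i) ≤ ∏ i, F i (y i) := by
    intro y hy
    have e : ∏ i, F i (y i) = (∏ i ∈ T, g (y i)) * ∏ i, f (y i) := by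
      rw [← Finset.univ_inter T, ← Finset.prod_ite_mem, ← Finset.prod_mul_distrib]
      refine Finset.prod_congr rfl fun i _ => ?_
      simp only [hF]
      split_ifs
      · rw [mul_comm]
      · rw [one_mul]
    rw [e]
    gcongr
    have hcard : (T.filter fun j => β ≤ ‖y j‖).card ≤ l := by
      have h : (T.filter fun j => β ≤ ‖clip M (y j)‖).card ≤ l := hy
      simpa only [le_norm_clip_iff hβ hM] using h
    simp only [hg]
    rw [Finset.prod_ite, Finset.prod_const, Finset.prod_const_one, mul_one]
    exact pow_le_pow_right_of_le_one' hs hcard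
  have hpm := measurableSet_passes T l hβ hM
  calc s ^ l * ∫⁻ y : Fin N → ℂ in passes T l β M, ∏ i, f (y i)
      = ∫⁻ y : Fin N → ℂ in passes T l β M, s ^ l * ∏ i, f (y i) := by
        rw [lintegral_const_mul' _ _ (ENNReal.pow_ne_top (ne_top_of_le_ne_top ENNReal.one_ne_top hs))]
    _ ≤ ∫⁻ y : Fin N → ℂ in passes T l β M, ∏ i, F i (y i) := setLIntegral_mono' hpm hpt
    _ ≤ ∫⁻ y : Fin N → ℂ, ∏ i, F i (y i) := setLIntegral_le_lintegral _ _
    _ = _ := by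
        rw [lintegral_fin_prod_eq_prod F hFm, Finset.prod_congr rfl fun i _ => hFint i,
          Finset.prod_ite_mem, Finset.univ_inter, Finset.prod_const, hT]

/-! ### The Chernoff exponent and the bound on the passing probability -/

theorem two_rpow_neg_mul_logb (n : ℕ) {x : ℝ} (hx : n ≠ 0 → 0 < x) :
    (2 : ℝ) ^ (-((n : ℝ) * Real.logb 2 x)) = x⁻¹ ^ n := by
  rcases n with _ | n
  · simp
  · have h := hx (by simp)
    rw [mul_comm, ← mul_neg, Real.rpow_mul (by norm_num), Real.rpow_logb (by norm_num) (by norm_num) h,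
      Real.rpow_neg h.le, Real.rpow_natCast, inv_pow]

/-- The Chernoff parameter for the binomial tail `{≤ l}` of `k` trials of probability `y`. -/
def chernoffParam (k l : ℕ) (y : ℝ) : ℝ := l * (1 - y) / (y * (k - l))

/-- `chernoffParam` minimizes `s^(-l) (1-y+ys)^k`; there `1-y+ys = k(1-y)/(k-l)`. Keeping `s ^ l` as
a factor instead of dividing covers `l = 0`, where `s = 0`. -/
theorem two_rpow_kl_mul_pow {k l : ℕ} (hk : 0 < k) {y : ℝ} (hly : (l : ℝ) / k < y) (hy : y < 1) :
    (2 : ℝ) ^ (-(k : ℝ) * kl (binary ((l : ℝ) / k)) (binary y)) * chernoffParam k l y ^ l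
      = (1 - y + y * chernoffParam k l y) ^ k := by
  have hk' : (0 : ℝ) < k := by exact_mod_cast hk
  have hy0 : 0 < y := lt_of_le_of_lt (by positivity) hly
  have hy1 : 0 < 1 - y := by linarith
  have hlk : (l : ℝ) < k := by
    have := hly.trans hy
    rwa [div_lt_one hk'] at this
  have hlk' : l < k := by exact_mod_cast hlk
  have hkl : (0 : ℝ) < k - l := by linarith
  have e0 : -(k : ℝ) * kl (binary ((l : ℝ) / k)) (binary y)
      = -(((k - l : ℕ) : ℝ) * Real.logb 2 (((k - l) / k) / (1 - y)))
        + -((l : ℝ) * Real.logb 2 ((l / k) / y)) := by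
    rw [kl, Fin.sum_univ_two, Nat.cast_sub hlk'.le]
    simp only [binary, Matrix.cons_val_zero, Matrix.cons_val_one]
    rw [show 1 - (l : ℝ) / k = (k - l) / k by field_simp]
    field_simp
    ring
  rw [e0, Real.rpow_add (by norm_num), two_rpow_neg_mul_logb _ fun _ => by positivity,
    two_rpow_neg_mul_logb _ fun h => by
      have : (0 : ℝ) < l := by exact_mod_cast Nat.pos_of_ne_zero h
      positivity]
  have e1 : 1 - y + y * chernoffParam k l y = ((k - l) / k / (1 - y))⁻¹ := by
    rw [chernoffParam]
    field_simp
    ring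
  have e2 : ((l : ℝ) / k / y)⁻¹ ^ l * chernoffParam k l y ^ l
      = ((k - l) / k / (1 - y))⁻¹ ^ l := by
    rcases Nat.eq_zero_or_pos l with rfl | hl
    · simp
    · have : (0 : ℝ) < l := by exact_mod_cast hl
      rw [← mul_pow, chernoffParam]
      congr 1
      field_simp
  rw [mul_assoc, e2, ← pow_add, Nat.sub_add_cancel hlk'.le, e1]

theorem outcomeLaw_passes_le {N k l : ℕ} (hk : 0 < k) {T : Finset (Fin N)} (hT : T.card = k)
    {w : ℝ} (hw1 : w ≤ 1) {nc : ℕ} {β M : ℝ} (hβ : 0 < β) (hM : β ≤ M)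
    {η ν : ℝ} (hη : 0 < η) (hη1 : η ≤ 1) (hν : 0 ≤ ν)
    (hl : (l : ℝ) / k < w / rNonideal η ν nc β) (ρ : DensityOperator)
    (hρ : w ≤ (tr (cutoffCompl nc ∘L ρ.op)).re ∨ w ≤ (tr (tailProj nc ∘L ρ.op)).re) :
    outcomeLaw (nonidealPOVM η ν) ρ N (passes T l β M)
      ≤ ENNReal.ofReal (epsET k l (w / rNonideal η ν nc β)) := by
  obtain ⟨S, hS, hSS⟩ := exists_sqrt_of_isPositive ρ.isPositive
  have hwt := testWeight_pos hη hη1 hν nc β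
  have hwt1 := testWeight_lt_one hη hη1 hν nc hβ
  have hk' : (0 : ℝ) < k := by exact_mod_cast hk
  set y := w / rNonideal η ν nc β with hy
  have hy' : y = testWeight η ν nc β * w := by rw [hy, rNonideal_eq hν, div_inv_eq_mul, mul_comm]
  have hy0 : 0 < y := lt_of_le_of_lt (by positivity) hl
  have hy1 : y < 1 := by nlinarith
  have hlk : (l : ℝ) < k := by
    have := hl.trans hy1
    rwa [div_lt_one hk'] at this
  have hkl : (0 : ℝ) < k - l := by linarith
  set s := chernoffParam k l y with hs
  have hs0 : 0 ≤ s := by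
    have : 0 < 1 - y := by linarith
    rw [hs, chernoffParam]
    positivity
  -- Equivalent to `l ≤ k y`: the threshold lies below the expected number of exceedances.
  have hs1 : s ≤ 1 := by
    rw [hs, chernoffParam, div_le_one (by positivity)]
    rw [div_lt_iff₀ hk'] at hl
    nlinarith
  have hB : MeasurableSet {y : ℂ | β ≤ ‖y‖} := measurableSet_le measurable_const measurable_norm
  set f := outcomeDensity η ν S with hf
  have hfm : Measurable f := measurable_outcomeDensity η ν S
  have hf1 : ∫⁻ y, f y = 1 := lintegral_outcomeDensity_univ hη hη1 hν hS hSS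
  have hadd := lintegral_add_compl (μ := volume) f hB
  rw [hf1] at hadd
  have hb : ENNReal.ofReal y ≤ ∫⁻ y in {y : ℂ | β ≤ ‖y‖}, f y := by
    refine le_trans (ENNReal.ofReal_le_ofReal ?_)
      (le_lintegral_outcomeDensity hη hη1 hν hβ.le hS hSS nc)
    rw [hy']
    exact mul_le_mul_of_nonneg_left (le_tailWeight hS hSS hρ) hwt.le
  have hmain := pow_mul_lintegral_passes_le (l := l) hT hfm hf1 hβ hM
    (s := ENNReal.ofReal s) (ENNReal.ofReal_le_one.2 hs1)
  have hlaw : outcomeLaw (nonidealPOVM η ν) ρ N (passes T l β M)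
      ≤ ENNReal.ofReal ((2 : ℝ) ^ (-(k : ℝ) * kl (binary ((l : ℝ) / k)) (binary y))) := by
    have hpm := measurableSet_passes (N := N) T l hβ hM
    rw [outcomeLaw, withDensity_apply _ hpm]
    simp only [ofReal_tr_tensorPow hη hη1 hν ρ S hS hSS]
    set b := ∫⁻ y in {y : ℂ | β ≤ ‖y‖}, f y with hbdef
    set a := ∫⁻ y in {y : ℂ | β ≤ ‖y‖}ᶜ, f y with hadef
    have hbt : b ≠ ⊤ := ne_top_of_le_ne_top ENNReal.one_ne_top (hadd ▸ le_self_add)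
    have hat : a ≠ ⊤ := ne_top_of_le_ne_top ENNReal.one_ne_top (hadd ▸ le_add_self)
    have hsum : b.toReal + a.toReal = 1 := by
      rw [← ENNReal.toReal_add hbt hat, hadd, ENNReal.toReal_one]
    have hyb : y ≤ b.toReal := (ENNReal.ofReal_le_iff_le_toReal hbt).1 hb
    -- With `a = 1 - b`, the base `1 - b (1 - s)` decreases in `b`, and `b ≥ y`.
    have hbase : ENNReal.ofReal s * b + a ≤ ENNReal.ofReal (1 - y + y * s) := by
      rw [← ENNReal.ofReal_toReal hbt, ← ENNReal.ofReal_toReal hat, ← ENNReal.ofReal_mul hs0,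
        ← ENNReal.ofReal_add (by positivity) (by positivity)]
      refine ENNReal.ofReal_le_ofReal ?_
      nlinarith
    have hnn : 0 ≤ 1 - y + y * s := by
      have := mul_nonneg hy0.le hs0
      linarith
    have h2 := hmain.trans (pow_le_pow_left' hbase k)
    rw [← ENNReal.ofReal_pow hnn, hs, ← two_rpow_kl_mul_pow hk hl hy1, ← hs,
      ENNReal.ofReal_mul (by positivity), ENNReal.ofReal_pow hs0, mul_comm] at h2
    -- The Chernoff parameter vanishes only for `l = 0`, where the power is `1`, so it can be
    -- cancelled.
    have hsl : ENNReal.ofReal s ^ l ≠ 0 := by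
      rcases Nat.eq_zero_or_pos l with h0 | h0
      · simp [h0]
      · refine pow_ne_zero _ ?_
        have h3 : (0 : ℝ) < l := by exact_mod_cast h0
        have h4 : 0 < 1 - y := by linarith
        have : 0 < s := by
          rw [hs, chernoffParam]
          positivity
        simpa using this
    exact (ENNReal.mul_le_mul_iff_left hsl (by finiteness)).1 h2
  refine hlaw.trans (ENNReal.ofReal_le_ofReal ?_)
  rw [epsET]
  refine le_mul_of_one_le_left (by positivity) ?_
  have : (0 : ℝ) ≤ l := Nat.cast_nonneg l
  linarith

/-! ### The ideal detector -/

theorem displacedKet_zero_right (γ : ℂ) : displacedKet γ 0 = coherent γ := by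
  apply lp.ext
  funext n
  rw [displacedKet_apply, dispCoeff, dispPoly_zero_right]
  change _ = (Real.exp (-‖γ‖ ^ 2 / 2) : ℂ) * γ ^ n / (Real.sqrt n.factorial : ℂ)
  simp
  ring

/-- At `n̄ = 0` the thermal state is the vacuum (`0^0 = 1` keeps only `k = 0`), and the displaced
vacuum is the coherent state. -/
theorem idealPOVM_eq : idealPOVM = nonidealPOVM 1 0 := by
  funext y
  have h : (1 - 1 + 0 : ℝ) / 1 = 0 := by norm_num
  rw [nonidealPOVM, idealPOVM, displacedThermal, h, tsum_eq_single 0]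
  · simp [displacedKet_zero_right]
  · intro k hk
    simp [hk]

end

end CVQKD

/-! ### The energy test for both detector models -/

theorem mainTheorem2 (N k l : ℕ) (hk : 0 < k) (T : Finset (Fin N)) (hT : T.card = k)
    (w : ℝ) (hw : w ∈ Set.Icc (0 : ℝ) 1) (nc : ℕ) (β M : ℝ) (hβ : 0 < β) (hM : β ≤ M) :
    -- ideal heterodyne detection
    ((∀ ψ : CVQKD.Mode, (inner ℂ ψ (CVQKD.tailProj nc ψ)).re ≤
        CVQKD.rIdeal nc β * CVQKD.testForm CVQKD.idealPOVM β ψ) ∧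
      ((l : ℝ) / k < w / CVQKD.rIdeal nc β →
        ∀ ρ : CVQKD.DensityOperator,
          (w ≤ (CVQKD.tr (CVQKD.cutoffCompl nc ∘L ρ.op)).re ∨
            w ≤ (CVQKD.tr (CVQKD.tailProj nc ∘L ρ.op)).re) →
          CVQKD.outcomeLaw CVQKD.idealPOVM ρ N (CVQKD.passes T l β M) ≤
            ENNReal.ofReal (CVQKD.epsET k l (w / CVQKD.rIdeal nc β)))) ∧
    -- trusted nonideal detectors
    (∀ η ν : ℝ, 0 < η → η ≤ 1 → 0 ≤ ν →
      (∀ ψ : CVQKD.Mode, (inner ℂ ψ (CVQKD.tailProj nc ψ)).re ≤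
        CVQKD.rNonideal η ν nc β * CVQKD.testForm (CVQKD.nonidealPOVM η ν) β ψ) ∧
      ((l : ℝ) / k < w / CVQKD.rNonideal η ν nc β →
        ∀ ρ : CVQKD.DensityOperator,
          (w ≤ (CVQKD.tr (CVQKD.cutoffCompl nc ∘L ρ.op)).re ∨
            w ≤ (CVQKD.tr (CVQKD.tailProj nc ∘L ρ.op)).re) →
          CVQKD.outcomeLaw (CVQKD.nonidealPOVM η ν) ρ N (CVQKD.passes T l β M) ≤
            ENNReal.ofReal (CVQKD.epsET k l (w / CVQKD.rNonideal η ν nc β)))) := by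
  have main : ∀ η ν : ℝ, 0 < η → η ≤ 1 → 0 ≤ ν →
      (∀ ψ : CVQKD.Mode, (inner ℂ ψ (CVQKD.tailProj nc ψ)).re ≤
        CVQKD.rNonideal η ν nc β * CVQKD.testForm (CVQKD.nonidealPOVM η ν) β ψ) ∧
      ((l : ℝ) / k < w / CVQKD.rNonideal η ν nc β →
        ∀ ρ : CVQKD.DensityOperator,
          (w ≤ (CVQKD.tr (CVQKD.cutoffCompl nc ∘L ρ.op)).re ∨
            w ≤ (CVQKD.tr (CVQKD.tailProj nc ∘L ρ.op)).re) →
          CVQKD.outcomeLaw (CVQKD.nonidealPOVM η ν) ρ N (CVQKD.passes T l β M) ≤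
            ENNReal.ofReal (CVQKD.epsET k l (w / CVQKD.rNonideal η ν nc β))) :=
    fun η ν hη hη1 hν => ⟨CVQKD.tailProj_le hη hη1 hν hβ nc, fun hl ρ hρ =>
      CVQKD.outcomeLaw_passes_le hk hT hw.2 hβ hM hη hη1 hν hl ρ hρ⟩
  refine ⟨?_, main⟩
  rw [CVQKD.idealPOVM_eq, ← CVQKD.rNonideal_one_zero]
  exact main 1 0 one_pos le_rfl le_rfl
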